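/- **Setting.** Let $m\ge 2$ clients be given. Client $i\in[m]$ has a sample space with a data distribution $\mathcal D_i$ and a loss $\ell_i(x;z)$, $x\in\mathbb R^d$, which is differentiable in $x$ and integrable in $z$ under $\mathcal D_i$. Put $F_i(x)=\mathbb E_{z\sim\mathcal D_i}[\ell_i(x;z)]$ and $F=\frac1m\sum_{i=1}^m F_i$; gradients are with respect to $x$. **FedPBC.** Fix the number of rounds $T\ge1$, the number of local steps $s\ge 1$, the learning rate $\eta>0$ and an initial point $x^0\in\mathbb R^d$. The server and all clients start at $x^0$, so $x_i^0=x^0$. In round $t=0,\dots,T-1$ each client $i$, using one stochastic sample $\xi_i^t$, sets $x_i^{(t,0)}=x_i^t$ and $$x_i^{(t,k+1)}=x_i^{(t,k)}-\eta\nabla\ell_i(x_i^{(t,k)};\xi_i^t),\quad k=0,\dots,s-1,\qquad x_i^{t\star}=x_i^{(t,s)}.$$ Let $\mathcal A^t\subseteq[m]$ be the random set of clients with an active uplink in round $t$. The server sets $x^{t+1}=\frac1{|\mathcal A^t|}\sum_{i\in\mathcal A^t}x_i^{t\star}$ if $\mathcal A^t\ne\emptyset$ and $x^{t+1}=x^t$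 otherwise; then $x_i^{t+1}=x^{t+1}$ for $i\in\mathcal A^t$ and $x_i^{t+1}=x_i^{t\star}$ for $i\notin\mathcal A^t$. Put $\bar x^t=\frac1m\sum_{i=1}^m x_i^t$. Let $\mathcal F^t$ be the $\sigma$-algebra generated by all $\xi_i^r$ and $\mathcal A^r$ with $r<t$. For each $t<T$, $\mathcal A^t$ is independent of $\mathcal F^t$ and $(\xi_i^t)_{i\in[m]}$ jointly; its distribution may depend on $t$ and is otherwise arbitrary. **Constants.** Let $W^{(t)}$ be the $m\times m$ matrix with $W^{(t)}_{ij}=1/|\mathcal A^t|$ if $i,j\in\mathcal A^t$, $W^{(t)}_{ii}=1$ if $i\notin\mathcal A^t$, and $W^{(t)}_{ij}=0$ otherwise. Let $\rho=\max_{0\le t\le T-1}\lambda_2\big(\mathbb E[(W^{(t)})^2]\big)$, where $\lambda_2$ is the second largest eigenvalue, counted with multiplicity. For $L_1,\dots,L_m\ge0$ put $L=\max_i L_i$ and $$\kappa=\max_{i}\frac{(1+\eta L_i)^s-1-s\eta L_i}{\binom s2(\eta L_i)^2},$$ with $\kappa=0$ if $s=1$; clients with $L_i=0$ are left out of this maximum.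 **Theorem.** Let $\sigma,\beta,\zeta\ge 0$ and $F^*\in\mathbb R$. Assume: 1. (Smoothness) $\|\nabla\ell_i(x;z)-\nabla\ell_i(y;z)\|\le L_i\|x-y\|$ for all $i$, $x$, $y$, $z$, and $L\ge1$. 2. (Unbiasedness and bounded variance) For all $t<T$ and $i$, almost surely $\mathbb E[\nabla\ell_i(x_i^t;\xi_i^t)\mid\mathcal F^t]=\nabla F_i(x_i^t)$, and for every $x\in\mathbb R^d$, almost surely $\mathbb E[\|\nabla\ell_i(x;\xi_i^t)-\nabla F_i(x)\|^2\mid\mathcal F^t]\le\sigma^2$. 3. (Lower bound) $F(x)\ge F^*$ for all $x$. 4. (Bounded dissimilarity) $\frac1m\sum_{i=1}^m\|\nabla F_i(x)-\nabla F(x)\|^2\le\beta^2\|\nabla F(x)\|^2+\zeta^2$ for all $x$. 5. (Learning rate) $0<\eta\le\dfrac{1-\sqrt\rho}{108\,L^2s^3(\beta^2+1)(1+\kappa^2L^2)}$. Then $\mathbb E\|\nabla F(\bar x^t)\|^2<\infty$ for all $t<T$, and $$\frac1T\sum_{t=0}^{T-1}\mathbb E\big[\|\nabla F(\bar x^t)\|^2\big]\le\frac{6\,(F(\bar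 x^0)-F^*)}{\eta sT}+54\,\eta sL\Big(\kappa^2L^2+1+\frac1{1-\sqrt\rho}\Big)(\sigma^2+\zeta^2).$$ -/

import Mathlib

open MeasureTheory ProbabilityTheory
open scoped NNReal Gradient

namespace FedPBC

noncomputable section

/-- Local objective `F_i(x) = E_{z ∼ D}[ℓ(x; z)]`. -/
def localObjective {d : ℕ} {Z : Type*} [MeasurableSpace Z]
    (ℓ : EuclideanSpace ℝ (Fin d) → Z → ℝ) (D : Measure Z)
    (x : EuclideanSpace ℝ (Fin d)) : ℝ :=
  ∫ z, ℓ x z ∂D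

/-- Global objective `F = (1/m) ∑ i, F_i`. -/
def globalObjective {m d : ℕ} {Ξ : Fin m → Type*} [∀ i, MeasurableSpace (Ξ i)]
    (ℓ : (i : Fin m) → EuclideanSpace ℝ (Fin d) → Ξ i → ℝ)
    (D : (i : Fin m) → Measure (Ξ i)) (x : EuclideanSpace ℝ (Fin d)) : ℝ :=
  (1 / (m : ℝ)) * ∑ i, localObjective (ℓ i) (D i) x

/-- The stochastic gradient `∇ℓ(x; z)` with respect to the model `x`. -/
def stochGrad {d : ℕ} {Z : Type*} (ℓ : EuclideanSpace ℝ (Fin d) → Z → ℝ)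
    (z : Z) (x : EuclideanSpace ℝ (Fin d)) : EuclideanSpace ℝ (Fin d) :=
  ∇ (fun y => ℓ y z) x

/-- `k` local gradient steps of size `η` with the gradient field `g`, started at `x`. -/
def localSteps {E : Type*} [AddCommGroup E] [Module ℝ E]
    (g : E → E) (η : ℝ) (x : E) : ℕ → E
  | 0 => x
  | k + 1 => localSteps g η x k - η • g (localSteps g η x k)

/-- One round of FedPBC, acting on (server model, client models). Every client performs `s`
local steps; the server averages the results of the clients in `S` (the active uplinks), or keeps
its model if `S` is empty; the clients in `S` receive the new server model at the end of the
round, while the others keep their own local result. -/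
def round {m : ℕ} {E : Type*} [AddCommGroup E] [Module ℝ E]
    (g : Fin m → E → E) (S : Finset (Fin m)) (η : ℝ) (s : ℕ)
    (p : E × (Fin m → E)) : E × (Fin m → E) :=
  let star : Fin m → E := fun i => localSteps (g i) η (p.2 i) s
  let server : E := if S.Nonempty then (1 / (S.card : ℝ)) • ∑ i ∈ S, star i else p.1
  (server, fun i => if i ∈ S then server else star i)

/-- The FedPBC state (server model, client models) at the start of round `t`, along one
realization: `g t i` is the gradient field that client `i` uses throughout round `t` and `S t` the
set of active uplinks in round `t`. -/
def state {m : ℕ} {E : Type*} [AddCommGroup E] [Module ℝ E]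
    (g : ℕ → Fin m → E → E) (S : ℕ → Finset (Fin m)) (η : ℝ) (s : ℕ) (x₀ : E) :
    ℕ → E × (Fin m → E)
  | 0 => (x₀, fun _ => x₀)
  | t + 1 => round (g t) (S t) η s (state g S η s x₀ t)

/-- The client model `x_i^t` as a random variable. In round `t` client `i` uses the single sample
`ξ i t` in all its local steps. -/
def clientModel {m d : ℕ} {Ω : Type*} {Ξ : Fin m → Type*}
    (ℓ : (i : Fin m) → EuclideanSpace ℝ (Fin d) → Ξ i → ℝ)
    (ξ : (i : Fin m) → ℕ → Ω → Ξ i) (A : ℕ → Ω → Finset (Fin m))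
    (η : ℝ) (s : ℕ) (x₀ : EuclideanSpace ℝ (Fin d)) (t : ℕ) (i : Fin m) (ω : Ω) :
    EuclideanSpace ℝ (Fin d) :=
  (state (fun r j => stochGrad (ℓ j) (ξ j r ω)) (fun r => A r ω) η s x₀ t).2 i

/-- The average client model `x̄^t = (1/m) ∑ i, x_i^t`. -/
def avgModel {m d : ℕ} {Ω : Type*} {Ξ : Fin m → Type*}
    (ℓ : (i : Fin m) → EuclideanSpace ℝ (Fin d) → Ξ i → ℝ)
    (ξ : (i : Fin m) → ℕ → Ω → Ξ i) (A : ℕ → Ω → Finset (Fin m))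
    (η : ℝ) (s : ℕ) (x₀ : EuclideanSpace ℝ (Fin d)) (t : ℕ) (ω : Ω) :
    EuclideanSpace ℝ (Fin d) :=
  (1 / (m : ℝ)) • ∑ i, clientModel ℓ ξ A η s x₀ t i ω

/-- The σ-algebra generated by the samples of round `t`. -/
abbrev sampleSigma {m : ℕ} {Ω : Type*} {Ξ : Fin m → Type*} [∀ i, MeasurableSpace (Ξ i)]
    (ξ : (i : Fin m) → ℕ → Ω → Ξ i) (t : ℕ) : MeasurableSpace Ω :=
  ⨆ i, MeasurableSpace.comap (ξ i t) inferInstance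

/-- The σ-algebra generated by the set of active uplinks of round `t`. -/
abbrev linkSigma {m : ℕ} {Ω : Type*} (A : ℕ → Ω → Finset (Fin m)) (t : ℕ) : MeasurableSpace Ω :=
  MeasurableSpace.comap (A t) ⊤

/-- `𝓕^t`: the σ-algebra generated by all the randomness (samples and uplinks) of the rounds
before round `t`. -/
abbrev history {m : ℕ} {Ω : Type*} {Ξ : Fin m → Type*} [∀ i, MeasurableSpace (Ξ i)]
    (ξ : (i : Fin m) → ℕ → Ω → Ξ i) (A : ℕ → Ω → Finset (Fin m)) (t : ℕ) :
    MeasurableSpace Ω :=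
  ⨆ r : Fin t, sampleSigma ξ r ⊔ linkSigma A r

/-- The implicit gossip matrix of a round whose set of active uplinks is `S`. -/
def gossipMatrix {m : ℕ} (S : Finset (Fin m)) : Matrix (Fin m) (Fin m) ℝ :=
  Matrix.of fun i j =>
    if i ∈ S ∧ j ∈ S then 1 / (S.card : ℝ) else if i = j then 1 else 0

/-- `M^{(t)} = E[(W^{(t)})²]`, entrywise expectation. -/
def meanSqGossip {m : ℕ} {Ω : Type*} [MeasurableSpace Ω] (P : Measure Ω)
    (A : ℕ → Ω → Finset (Fin m)) (t : ℕ) : Matrix (Fin m) (Fin m) ℝ :=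
  Matrix.of fun i j => ∫ ω, (gossipMatrix (A t ω) ^ 2) i j ∂P

theorem gossipMatrix_isHermitian {m : ℕ} (S : Finset (Fin m)) :
    (gossipMatrix S).IsHermitian := by
  ext i j
  simp only [Matrix.conjTranspose_apply, gossipMatrix, Matrix.of_apply, star_trivial,
    and_comm, eq_comm]

theorem meanSqGossip_isHermitian {m : ℕ} {Ω : Type*} [MeasurableSpace Ω] (P : Measure Ω)
    (A : ℕ → Ω → Finset (Fin m)) (t : ℕ) : (meanSqGossip P A t).IsHermitian := by
  ext i j
  simp only [Matrix.conjTranspose_apply, meanSqGossip, Matrix.of_apply, star_trivial]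
  refine integral_congr_ae (Filter.Eventually.of_forall fun ω => ?_)
  have h := ((gossipMatrix_isHermitian (A t ω)).pow 2).apply i j
  simpa using h

/-- `λ₂`: the second largest eigenvalue, counted with multiplicity, of a real symmetric matrix of
size at least two. (`eigenvalues₀` lists the eigenvalues in decreasing order.) -/
def lambda2 {m : ℕ} (hm : 2 ≤ m) {M : Matrix (Fin m) (Fin m) ℝ} (hM : M.IsHermitian) : ℝ :=
  hM.eigenvalues₀ ⟨1, by rw [Fintype.card_fin]; omega⟩

/-- `ρ = max_t λ₂(M^{(t)})`, the maximum over the rounds `t = 0, …, T - 1`. -/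
def rho {m : ℕ} (hm : 2 ≤ m) {Ω : Type*} [MeasurableSpace Ω] (P : Measure Ω)
    (A : ℕ → Ω → Finset (Fin m)) (T : ℕ) : ℝ :=
  ⨆ t : Fin T, lambda2 hm (meanSqGossip_isHermitian P A t)

/-- `L = max_i L_i`. -/
def maxLip {m : ℕ} (L : Fin m → ℝ≥0) : ℝ := ⨆ i, (L i : ℝ)

/-- `κ = max_i ((1 + η L_i)^s - 1 - s η L_i) / (binom(s,2) (η L_i)²)`. For `s = 1` this is `0`. If
`s ≥ 2`, a client with `L_i = 0` contributes `0`, which does not affect the maximum as soon as some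
`L_j` is positive. -/
def kappa {m : ℕ} (L : Fin m → ℝ≥0) (η : ℝ) (s : ℕ) : ℝ :=
  ⨆ i, ((1 + η * L i) ^ s - 1 - s * η * L i) / ((s.choose 2 : ℝ) * (η * L i) ^ 2)

end

end FedPBC

/-!
An inactive client keeps its own local result, so one round is a local step followed by
multiplication with the gossip matrix `W`, which is doubly stochastic. Hence the mean of the client
models moves by the averaged local gradients only, and the descent lemma for `F` along it costs the
spread of the client models (the mean squared distance to their mean) and the size of the
stochastic gradients. As `W` is independent of the models it averages, it contracts the expected
spread by `λ₂(E[W²]) ≤ ρ`, so the spread accumulated over all rounds is controlled by the stochastic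
gradients as well. The sum of the `s` local gradients of a round is `s` times the first one up to a
relative error governed by `κ`; only that first gradient is unbiased. The condition on `η` makes all
these terms small enough to be absorbed into the descent.
-/

namespace FedPBC

section Averages

variable {ι : Type*} [Fintype ι]

/-- The average `(1/|ι|) ∑ i, x i` of a finite family of vectors; it is `0` for an empty family. -/
noncomputable def mean {E : Type*} [AddCommGroup E] [Module ℝ E] (x : ι → E) : E :=
  (Fintype.card ι : ℝ)⁻¹ • ∑ i, x i

section Module

variable {E : Type*} [AddCommGroup E] [Module ℝ E]

theorem mean_add (x y : ι → E) : mean (fun i => x i + y i) = mean x + mean y := by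
  rw [mean, Finset.sum_add_distrib, smul_add, mean, mean]

theorem mean_sub (x y : ι → E) : mean (fun i => x i - y i) = mean x - mean y := by
  rw [mean, Finset.sum_sub_distrib, smul_sub, mean, mean]

theorem mean_smul (c : ℝ) (x : ι → E) : mean (fun i => c • x i) = c • mean x := by
  rw [mean, ← Finset.smul_sum, smul_comm, mean]

theorem card_smul_mean [Nonempty ι] (x : ι → E) : (Fintype.card ι : ℝ) • mean x = ∑ i, x i :=
  smul_inv_smul₀ (Nat.cast_ne_zero.2 Fintype.card_ne_zero) _

theorem mean_const [Nonempty ι] (c : E) : mean (fun _ : ι => c) = c := by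
  rw [mean, Finset.sum_const, Finset.card_univ, ← Nat.cast_smul_eq_nsmul ℝ,
    inv_smul_smul₀ (Nat.cast_ne_zero.2 Fintype.card_ne_zero)]

theorem sum_sub_mean [Nonempty ι] (x : ι → E) : ∑ i, (x i - mean x) = 0 := by
  rw [← card_smul_mean, mean_sub, mean_const, sub_self, smul_zero]

theorem mean_const_mul (c : ℝ) (x : ι → ℝ) : mean (fun i => c * x i) = c * mean x :=
  mean_smul c x

end Module

theorem mean_le_mean {x y : ι → ℝ} (h : ∀ i, x i ≤ y i) : mean x ≤ mean y :=
  smul_le_smul_of_nonneg_left (Finset.sum_le_sum fun i _ => h i) (by positivity)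

theorem mean_nonneg {x : ι → ℝ} (h : ∀ i, 0 ≤ x i) : 0 ≤ mean x :=
  smul_nonneg (by positivity) (Finset.sum_nonneg fun i _ => h i)

section NormedSpace

variable {E : Type*} [NormedAddCommGroup E] [NormedSpace ℝ E]

theorem norm_mean_le (x : ι → E) : ‖mean x‖ ≤ mean fun i => ‖x i‖ := by
  rw [mean, mean, norm_smul, Real.norm_of_nonneg (by positivity), smul_eq_mul]
  gcongr
  exact norm_sum_le _ _

theorem lipschitzWith_mean [Nonempty ι] {F : Type*} [SeminormedAddCommGroup F] {K : ℝ≥0}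
    {H : ι → F → E} (hH : ∀ i, LipschitzWith K (H i)) :
    LipschitzWith K fun x => mean (H · x) := by
  refine LipschitzWith.of_dist_le_mul fun x y => ?_
  rw [dist_eq_norm, dist_eq_norm, ← mean_sub]
  calc ‖mean fun i => H i x - H i y‖ ≤ mean fun i => ‖H i x - H i y‖ := norm_mean_le _
    _ ≤ mean fun _ : ι => K * ‖x - y‖ := mean_le_mean fun i => (hH i).norm_sub_le x y
    _ = K * ‖x - y‖ := mean_const _

variable {Ω : Type*} {mΩ : MeasurableSpace Ω} {P : Measure Ω} {X : ι → Ω → E}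

theorem stronglyMeasurable_mean (h : ∀ i, StronglyMeasurable (X i)) :
    StronglyMeasurable fun ω => mean (X · ω) :=
  (Finset.stronglyMeasurable_fun_sum _ fun i _ => h i).const_smul _

theorem memLp_mean {p : ENNReal} (h : ∀ i, MemLp (X i) p P) : MemLp (fun ω => mean (X · ω)) p P :=
  (memLp_finsetSum _ fun i _ => h i).const_smul (Fintype.card ι : ℝ)⁻¹

theorem integrable_mean (h : ∀ i, Integrable (X i) P) : Integrable (fun ω => mean (X · ω)) P :=
  (integrable_finsetSum _ fun i _ => h i).smul (Fintype.card ι : ℝ)⁻¹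

theorem integral_mean (h : ∀ i, Integrable (X i) P) :
    ∫ ω, mean (X · ω) ∂P = mean fun i => ∫ ω, X i ω ∂P := by
  simp only [mean]
  rw [integral_smul, integral_finsetSum _ fun i _ => h i]

end NormedSpace

/-- The average of the squared norms of a finite family of vectors. -/
noncomputable def avgSq {E : Type*} [Norm E] (x : ι → E) : ℝ := mean fun i => ‖x i‖ ^ 2

theorem avgSq_nonneg {E : Type*} [Norm E] (x : ι → E) : 0 ≤ avgSq x :=
  mean_nonneg fun _ => sq_nonneg _

theorem avgSq_le_sq_mul_avgSq {E F : Type*} [SeminormedAddGroup E] [Norm F] {x : ι → E} {y : ι → F}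
    {c : ℝ} (h : ∀ i, ‖x i‖ ≤ c * ‖y i‖) : avgSq x ≤ c ^ 2 * avgSq y := by
  rw [avgSq, avgSq, ← mean_const_mul]
  refine mean_le_mean fun i => ?_
  rw [← mul_pow]
  exact pow_le_pow_left₀ (norm_nonneg _) (h i) 2

theorem avgSq_smul {E : Type*} [NormedAddCommGroup E] [NormedSpace ℝ E] (c : ℝ) (x : ι → E) :
    avgSq (fun i => c • x i) = c ^ 2 * avgSq x := by
  simp only [avgSq, norm_smul, mul_pow, mean_const_mul, Real.norm_eq_abs, sq_abs]

theorem norm_add_sq_le {E : Type*} [SeminormedAddGroup E] (a b : E) :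
    ‖a + b‖ ^ 2 ≤ 2 * ‖a‖ ^ 2 + 2 * ‖b‖ ^ 2 :=
  (pow_le_pow_left₀ (norm_nonneg _) (norm_add_le a b) 2).trans
    (by linarith [add_sq_le (a := ‖a‖) (b := ‖b‖)])

theorem avgSq_add_le {E : Type*} [SeminormedAddGroup E] (x y : ι → E) :
    avgSq (fun i => x i + y i) ≤ 2 * avgSq x + 2 * avgSq y := by
  simp only [avgSq, ← mean_const_mul, ← mean_add]
  exact mean_le_mean fun i => norm_add_sq_le (x i) (y i)

section Spread

variable {E : Type*} [NormedAddCommGroup E] [InnerProductSpace ℝ E]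

theorem inner_mean (a : E) (x : ι → E) : inner ℝ a (mean x) = mean fun i => inner ℝ a (x i) := by
  rw [mean, real_inner_smul_right, inner_sum, mean, smul_eq_mul]

/-- The average squared distance of a finite family of vectors to its average: the consensus
error when the vectors are the models of the clients. -/
noncomputable def spread (x : ι → E) : ℝ := avgSq fun i => x i - mean x

theorem spread_nonneg (x : ι → E) : 0 ≤ spread x := avgSq_nonneg _

variable [Nonempty ι]

theorem spread_const (c : E) : spread (fun _ : ι => c) = 0 := by
  simp [spread, avgSq, mean_const]

theorem spread_eq_avgSq_sub (x : ι → E) : spread x = avgSq x - ‖mean x‖ ^ 2 := by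
  simp only [spread, avgSq, norm_sub_sq_real, mean_add, mean_sub, mean_const_mul, mean_const,
    real_inner_comm (mean x), ← inner_mean, real_inner_self_eq_norm_sq]
  ring

theorem norm_mean_sq_le_avgSq (x : ι → E) : ‖mean x‖ ^ 2 ≤ avgSq x := by
  linarith [spread_nonneg x, spread_eq_avgSq_sub x]

theorem spread_le_avgSq (x : ι → E) : spread x ≤ avgSq x := by
  linarith [sq_nonneg ‖mean x‖, spread_eq_avgSq_sub x]

end Spread

-- With `c = 1 - r`, the defect is `(r (c‖a‖ - r‖b‖)² + (1 - r²)‖b‖²) / c`.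
theorem sq_mul_norm_sub_sq_le {E : Type*} [SeminormedAddCommGroup E] {r : ℝ} (hr₀ : 0 ≤ r)
    (hr₁ : r < 1) (a b : E) :
    r ^ 2 * ‖a - b‖ ^ 2 ≤ r * ‖a‖ ^ 2 + 1 / (1 - r) * ‖b‖ ^ 2 := by
  have hc : 0 < 1 - r := sub_pos.2 hr₁
  have hr_sq : 0 ≤ 1 - r ^ 2 := sub_nonneg.2 (pow_le_one₀ hr₀ hr₁.le)
  have defect : r * ‖a‖ ^ 2 + 1 / (1 - r) * ‖b‖ ^ 2 - r ^ 2 * (‖a‖ + ‖b‖) ^ 2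
      = (r * ((1 - r) * ‖a‖ - r * ‖b‖) ^ 2 + (1 - r ^ 2) * ‖b‖ ^ 2) / (1 - r) := by
    field_simp
    ring
  calc r ^ 2 * ‖a - b‖ ^ 2 ≤ r ^ 2 * (‖a‖ + ‖b‖) ^ 2 := by gcongr; exact norm_sub_le a b
    _ ≤ r * ‖a‖ ^ 2 + 1 / (1 - r) * ‖b‖ ^ 2 := by
      rw [← sub_nonneg, defect]
      positivity

theorem sq_mul_spread_sub_le [Nonempty ι] {E : Type*} [NormedAddCommGroup E]
    [InnerProductSpace ℝ E] {r : ℝ} (hr₀ : 0 ≤ r) (hr₁ : r < 1) (x y : ι → E) :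
    r ^ 2 * spread (fun i => x i - y i) ≤ r * spread x + 1 / (1 - r) * avgSq y := by
  have : 0 < 1 - r := sub_pos.2 hr₁
  calc r ^ 2 * spread (fun i => x i - y i) ≤ r * spread x + 1 / (1 - r) * spread y := by
        simp only [spread, avgSq, mean_sub x y, ← mean_const_mul, ← mean_add]
        refine mean_le_mean fun i => ?_
        rw [sub_sub_sub_comm]
        exact sq_mul_norm_sub_sq_le hr₀ hr₁ _ _
    _ ≤ r * spread x + 1 / (1 - r) * avgSq y := by gcongr; exact spread_le_avgSq y

section Integrability

variable {Ω : Type*} {mΩ : MeasurableSpace Ω} {P : Measure Ω} {E : Type*} [NormedAddCommGroup E]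
  {X : ι → Ω → E}

theorem integrable_avgSq (h : ∀ i, MemLp (X i) 2 P) : Integrable (fun ω => avgSq (X · ω)) P :=
  integrable_mean fun i => (h i).integrable_norm_pow two_ne_zero

theorem integrable_spread [InnerProductSpace ℝ E] (h : ∀ i, MemLp (X i) 2 P) :
    Integrable (fun ω => spread (X · ω)) P :=
  integrable_avgSq (X := fun i ω => X i ω - mean (X · ω)) fun i => (h i).sub (memLp_mean h)

end Integrability

end Averages

section LocalSteps

variable {E : Type*} [NormedAddCommGroup E] [NormedSpace ℝ E]

/-- The sum of the gradients used along `n` local steps. -/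
noncomputable def pathGrad (g : E → E) (η : ℝ) (x : E) (n : ℕ) : E :=
  ∑ k ∈ Finset.range n, g (localSteps g η x k)

theorem localSteps_eq_sub_pathGrad (g : E → E) (η : ℝ) (x : E) (n : ℕ) :
    localSteps g η x n = x - η • pathGrad g η x n := by
  induction n with
  | zero => simp [localSteps, pathGrad]
  | succ n ih =>
    rw [pathGrad, Finset.sum_range_succ, smul_add, ← sub_sub, ← pathGrad, ← ih, localSteps]

variable {g : E → E} {K : ℝ≥0} {η : ℝ}

theorem mul_norm_localSteps_sub_le (hg : LipschitzWith K g) (hη : 0 ≤ η) (x : E) (n : ℕ) :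
    K * ‖localSteps g η x n - x‖ ≤ ((1 + η * K) ^ n - 1) * ‖g x‖ := by
  induction n with
  | zero => simp [localSteps]
  | succ n ih =>
    set y := localSteps g η x n with hy
    have grad_le : ‖g y‖ ≤ ‖g x‖ + K * ‖y - x‖ :=
      (norm_le_norm_add_norm_sub' _ _).trans (by gcongr; exact hg.norm_sub_le y x)
    have step_le : ‖localSteps g η x (n + 1) - x‖ ≤ ‖y - x‖ + η * ‖g y‖ := by
      rw [localSteps, ← hy, sub_right_comm]
      exact (norm_sub_le _ _).trans_eq (by rw [norm_smul, Real.norm_of_nonneg hη])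
    calc K * ‖localSteps g η x (n + 1) - x‖
        ≤ K * (‖y - x‖ + η * (‖g x‖ + K * ‖y - x‖)) := by gcongr; exact step_le.trans (by gcongr)
      _ = (1 + η * K) * (K * ‖y - x‖) + η * K * ‖g x‖ := by ring
      _ ≤ (1 + η * K) * (((1 + η * K) ^ n - 1) * ‖g x‖) + η * K * ‖g x‖ := by gcongr
      _ = ((1 + η * K) ^ (n + 1) - 1) * ‖g x‖ := by ring

theorem norm_pathGrad_sub_le (hg : LipschitzWith K g) (hη : 0 ≤ η) (x : E) (n : ℕ) :
    ‖pathGrad g η x n - (n : ℝ) • g x‖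
      ≤ (∑ k ∈ Finset.range n, ((1 + η * K) ^ k - 1)) * ‖g x‖ := by
  have hsum : pathGrad g η x n - (n : ℝ) • g x
      = ∑ k ∈ Finset.range n, (g (localSteps g η x k) - g x) := by
    rw [pathGrad, Finset.sum_sub_distrib, Finset.sum_const, Finset.card_range,
      Nat.cast_smul_eq_nsmul]
  rw [hsum, Finset.sum_mul]
  exact (norm_sum_le _ _).trans (Finset.sum_le_sum fun k _ =>
    (hg.norm_sub_le _ _).trans (mul_norm_localSteps_sub_le hg hη x k))

theorem norm_le_of_norm_sub_smul_le {a b : E} {c δ : ℝ} (hc : 0 ≤ c)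
    (h : ‖a - c • b‖ ≤ δ * ‖b‖) : ‖a‖ ≤ (c + δ) * ‖b‖ := by
  calc ‖a‖ ≤ ‖c • b‖ + ‖a - c • b‖ := norm_le_norm_add_norm_sub' _ _
    _ ≤ c * ‖b‖ + δ * ‖b‖ := by rw [norm_smul, Real.norm_of_nonneg hc]; gcongr
    _ = (c + δ) * ‖b‖ := (add_mul _ _ _).symm

end LocalSteps

section Constants

theorem mul_sum_one_add_pow_sub_one {R : Type*} [CommRing R] (a : R) (n : ℕ) :
    a * ∑ k ∈ Finset.range n, ((1 + a) ^ k - 1) = (1 + a) ^ n - 1 - n * a := by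
  induction n with
  | zero => simp
  | succ n ih => rw [Finset.sum_range_succ, mul_add, ih]; push_cast; ring

theorem sum_one_add_pow_sub_one_nonneg {a : ℝ} (ha : 0 ≤ a) (n : ℕ) :
    0 ≤ ∑ k ∈ Finset.range n, ((1 + a) ^ k - 1) :=
  Finset.sum_nonneg fun _ _ => sub_nonneg.2 (one_le_pow₀ (by linarith))

variable {m : ℕ} (L : Fin m → ℝ≥0)

theorem le_maxLip (i : Fin m) : (L i : ℝ) ≤ maxLip L :=
  le_ciSup (f := fun i => (L i : ℝ)) (Set.finite_range _).bddAbove i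

theorem maxLip_nonneg : 0 ≤ maxLip L := Real.iSup_nonneg fun i => (L i).2

theorem le_kappa (η : ℝ) (s : ℕ) (i : Fin m) :
    ((1 + η * L i) ^ s - 1 - s * η * L i) / ((s.choose 2 : ℝ) * (η * L i) ^ 2) ≤ kappa L η s :=
  le_ciSup (f := fun i => ((1 + η * L i) ^ s - 1 - s * η * L i) /
    ((s.choose 2 : ℝ) * (η * L i) ^ 2)) (Set.finite_range _).bddAbove i

theorem kappa_nonneg {η : ℝ} (hη : 0 ≤ η) (s : ℕ) : 0 ≤ kappa L η s := by
  refine Real.iSup_nonneg fun i => div_nonneg ?_ (by positivity)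
  rw [mul_assoc, ← mul_sum_one_add_pow_sub_one]
  exact mul_nonneg (by positivity) (sum_one_add_pow_sub_one_nonneg (by positivity) s)

/-- `κ · binom(s, 2) · η · L`: the relative error that is made when the `s` local gradients of a
round are replaced by `s` times the first one. -/
noncomputable def drift (η : ℝ) (s : ℕ) : ℝ := kappa L η s * s.choose 2 * η * maxLip L

theorem drift_nonneg {η : ℝ} (hη : 0 ≤ η) (s : ℕ) : 0 ≤ drift L η s := by
  have := kappa_nonneg L hη s
  have := maxLip_nonneg L
  unfold drift
  positivity

theorem drift_le {η : ℝ} (hη : 0 ≤ η) (s : ℕ) :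
    drift L η s ≤ kappa L η s * (s ^ 2 / 2) * η * maxLip L := by
  have := kappa_nonneg L hη s
  have := maxLip_nonneg L
  have choose_le : (s.choose 2 : ℝ) ≤ s ^ 2 / 2 := by
    simpa using Nat.choose_le_pow_div (α := ℝ) 2 s
  unfold drift
  gcongr

theorem sum_one_add_pow_sub_one_le_drift {η : ℝ} (hη : 0 < η) (s : ℕ) (i : Fin m) :
    ∑ k ∈ Finset.range s, ((1 + η * L i) ^ k - 1) ≤ drift L η s := by
  rcases Nat.lt_or_ge s 2 with hs | hs
  · exact le_of_eq_of_le (by interval_cases s <;> simp) (drift_nonneg L hη.le s)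
  rcases (L i).2.eq_or_lt with hLi | hLi
  · have hLi : L i = 0 := NNReal.coe_eq_zero.1 hLi.symm
    simpa [hLi] using drift_nonneg L hη.le s
  replace hLi : (0 : ℝ) < L i := hLi
  have hchoose : (0 : ℝ) < s.choose 2 := by exact_mod_cast Nat.choose_pos hs
  have hκ := le_kappa L η s i
  rw [div_le_iff₀ (by positivity), mul_assoc (s : ℝ), ← mul_sum_one_add_pow_sub_one] at hκ
  calc ∑ k ∈ Finset.range s, ((1 + η * L i) ^ k - 1)
      ≤ kappa L η s * s.choose 2 * η * L i :=
        le_of_mul_le_mul_left (hκ.trans_eq (by ring)) (mul_pos hη hLi)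
    _ ≤ drift L η s := by
      have := kappa_nonneg L hη.le s
      unfold drift
      gcongr
      exact le_maxLip L i

end Constants

section Gossip

variable {m : ℕ}

theorem gossipMatrix_apply_of_mem {S : Finset (Fin m)} {i : Fin m} (hi : i ∈ S) (j : Fin m) :
    gossipMatrix S i j = if j ∈ S then 1 / (S.card : ℝ) else 0 := by
  by_cases hj : j ∈ S
  · simp [gossipMatrix, hi, hj]
  · simp [gossipMatrix, hj, ne_of_mem_of_not_mem hi hj]

theorem sum_gossipMatrix (S : Finset (Fin m)) (i : Fin m) : ∑ j, gossipMatrix S i j = 1 := by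
  by_cases hi : i ∈ S
  · have hS : (S.card : ℝ) ≠ 0 := Nat.cast_ne_zero.2 (Finset.card_ne_zero_of_mem hi)
    simp [gossipMatrix_apply_of_mem hi, hS]
  · simp [gossipMatrix, hi]

theorem gossipMatrix_symm (S : Finset (Fin m)) (i j : Fin m) :
    gossipMatrix S i j = gossipMatrix S j i := by
  simpa using (gossipMatrix_isHermitian S).apply j i

theorem sum_gossipMatrix_sq (S : Finset (Fin m)) (i : Fin m) :
    ∑ j, (gossipMatrix S ^ 2) i j = 1 := by
  simp only [pow_two, Matrix.mul_apply]
  rw [Finset.sum_comm]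
  simp only [← Finset.mul_sum, sum_gossipMatrix, mul_one]

theorem gossipMatrix_nonneg (S : Finset (Fin m)) (i j : Fin m) : 0 ≤ gossipMatrix S i j := by
  simp only [gossipMatrix, Matrix.of_apply]
  split_ifs <;> positivity

theorem gossipMatrix_le_one (S : Finset (Fin m)) (i j : Fin m) : gossipMatrix S i j ≤ 1 := by
  rw [← sum_gossipMatrix S i]
  exact Finset.single_le_sum (fun k _ => gossipMatrix_nonneg S i k) (Finset.mem_univ j)

section Module

variable {E : Type*} [AddCommGroup E] [Module ℝ E]

/-- The gossip matrix of `S` acting on a family of vectors: the members of `S` move to their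
average, the other vectors stay. -/
noncomputable def gossip (S : Finset (Fin m)) (y : Fin m → E) (i : Fin m) : E :=
  ∑ j, gossipMatrix S i j • y j

theorem round_snd (g : Fin m → E → E) (S : Finset (Fin m)) (η : ℝ) (s : ℕ) (p : E × (Fin m → E)) :
    (round g S η s p).2 = gossip S fun j => localSteps (g j) η (p.2 j) s := by
  funext i
  by_cases hi : i ∈ S
  · have hS : S.Nonempty := ⟨i, hi⟩
    simp [gossip, gossipMatrix_apply_of_mem hi, round, hi, hS, Finset.smul_sum, ite_smul]
  · simp [gossip, gossipMatrix, round, hi, ite_smul]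

theorem mean_gossip (S : Finset (Fin m)) (y : Fin m → E) : mean (gossip S y) = mean y := by
  simp only [mean, gossip]
  rw [Finset.sum_comm]
  simp only [gossipMatrix_symm S _, ← Finset.sum_smul, sum_gossipMatrix, one_smul]

theorem gossip_sub_const (S : Finset (Fin m)) (y : Fin m → E) (c : E) (i : Fin m) :
    gossip S (fun j => y j - c) i = gossip S y i - c := by
  simp only [gossip, smul_sub, Finset.sum_sub_distrib, ← Finset.sum_smul, sum_gossipMatrix,
    one_smul]

end Module

variable {E : Type*} [NormedAddCommGroup E] [InnerProductSpace ℝ E]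

/-- The quadratic form of a matrix on families of vectors: for scalars, `yᵀ M y`. -/
noncomputable def quadForm {ι : Type*} [Fintype ι] (M : Matrix ι ι ℝ) (y : ι → E) : ℝ :=
  ∑ i, ∑ j, M i j * inner ℝ (y i) (y j)

theorem sum_norm_sq_gossip (S : Finset (Fin m)) (y : Fin m → E) :
    ∑ i, ‖gossip S y i‖ ^ 2 = quadForm (gossipMatrix S ^ 2) y := by
  simp only [← real_inner_self_eq_norm_sq, gossip, quadForm, sum_inner, inner_sum,
    real_inner_smul_left, real_inner_smul_right, pow_two (gossipMatrix S), Matrix.mul_apply,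
    Finset.sum_mul]
  rw [Finset.sum_comm]
  refine Finset.sum_congr rfl fun j _ => ?_
  rw [Finset.sum_comm]
  refine Finset.sum_congr rfl fun k _ => Finset.sum_congr rfl fun i _ => ?_
  rw [gossipMatrix_symm S j i, real_inner_comm]
  ring

theorem spread_gossip (S : Finset (Fin m)) (y : Fin m → E) :
    spread (gossip S y) = (m : ℝ)⁻¹ * quadForm (gossipMatrix S ^ 2) fun i => y i - mean y := by
  simp only [spread, avgSq, mean_gossip, ← gossip_sub_const]
  rw [mean, Fintype.card_fin, smul_eq_mul, sum_norm_sq_gossip]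

end Gossip

section Spectral

section Symmetric

variable {E : Type*} [NormedAddCommGroup E] [InnerProductSpace ℝ E] [FiniteDimensional ℝ E]
  {T : E →ₗ[ℝ] E} (hT : T.IsSymmetric) {n : ℕ} (hn : Module.finrank ℝ E = n)

theorem eigenvectorBasis_repr_eq_zero {μ : ℝ} {u : E} (hu : T u = μ • u) {i : Fin n}
    (hi : hT.eigenvalues hn i ≠ μ) : (hT.eigenvectorBasis hn).repr u i = 0 := by
  have h := hT.eigenvectorBasis_apply_self_apply hn u i
  rw [hu, map_smul, PiLp.smul_apply, smul_eq_mul] at h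
  exact (mul_eq_mul_right_iff.1 h).resolve_left fun h => hi h.symm

theorem inner_apply_self_eq_sum_eigenvalues (w : E) :
    inner ℝ w (T w)
      = ∑ i, hT.eigenvalues hn i * (hT.eigenvectorBasis hn).repr w i ^ 2 := by
  rw [← (hT.eigenvectorBasis hn).repr.inner_map_map, PiLp.inner_apply]
  refine Finset.sum_congr rfl fun i _ => ?_
  rw [hT.eigenvectorBasis_apply_self_apply hn, RCLike.inner_apply, conj_trivial]
  simp only [RCLike.ofReal_real_eq_id, id_eq]
  ring

/-- An eigenvector whose eigenvalue exceeds the second largest one spans the top eigenspace, so the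
Rayleigh quotient on its orthogonal complement is at most the second largest eigenvalue. -/
theorem inner_apply_self_le_second_eigenvalue {i₁ : Fin n} (hi₁ : (i₁ : ℕ) = 1) {μ : ℝ} {u : E}
    (hu₀ : u ≠ 0) (hu : T u = μ • u) (hμ : hT.eigenvalues hn i₁ < μ) {w : E}
    (hw : inner ℝ u w = 0) : inner ℝ w (T w) ≤ hT.eigenvalues hn i₁ * ‖w‖ ^ 2 := by
  set b := hT.eigenvectorBasis hn
  let i₀ : Fin n := ⟨0, i₁.pos⟩
  have le_second : ∀ i, i ≠ i₀ → hT.eigenvalues hn i ≤ hT.eigenvalues hn i₁ := fun i hi =>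
    hT.eigenvalues_antitone hn (Fin.le_def.2
      (hi₁ ▸ Nat.one_le_iff_ne_zero.2 fun h => hi (Fin.ext h)))
  have repr_u : ∀ i, i ≠ i₀ → b.repr u i = 0 := fun i hi =>
    eigenvectorBasis_repr_eq_zero hT hn hu ((le_second i hi).trans_lt hμ).ne
  have repr_u₀ : b.repr u i₀ ≠ 0 := fun h => hu₀ <| b.repr.map_eq_zero_iff.1 <| by
    ext i
    exact (eq_or_ne i i₀).elim (fun hi => hi ▸ h) (repr_u i)
  have repr_w₀ : b.repr w i₀ = 0 := by
    rw [← b.repr.inner_map_map, PiLp.inner_apply,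
      Finset.sum_eq_single i₀ (fun i _ hi => by simp [repr_u i hi]) (by simp)] at hw
    simpa [repr_u₀] using hw
  rw [inner_apply_self_eq_sum_eigenvalues hT hn, ← b.repr.norm_map w, EuclideanSpace.norm_sq_eq,
    Finset.mul_sum]
  refine Finset.sum_le_sum fun i _ => ?_
  rw [Real.norm_eq_abs, sq_abs]
  rcases eq_or_ne i i₀ with rfl | hi
  · exact (by rw [repr_w₀]; simp : _ = (_ : ℝ)).le
  · exact mul_le_mul_of_nonneg_right (le_second i hi) (sq_nonneg _)

end Symmetric

variable {m : ℕ} (hm : 2 ≤ m) {M : Matrix (Fin m) (Fin m) ℝ} (hM : M.IsHermitian)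
  (hM₁ : ∀ i, ∑ j, M i j = 1) (hlt : lambda2 hm hM < 1)
include hM₁ hlt

theorem quadForm_le_lambda2_mul_of_real {v : Fin m → ℝ} (hv : ∑ i, v i = 0) :
    quadForm M v ≤ lambda2 hm hM * ∑ i, v i ^ 2 := by
  let u : EuclideanSpace ℝ (Fin m) := WithLp.toLp 2 fun _ => 1
  let w : EuclideanSpace ℝ (Fin m) := WithLp.toLp 2 v
  have hu₀ : u ≠ 0 := fun h =>
    one_ne_zero (congrArg (fun x : EuclideanSpace ℝ (Fin m) => x ⟨0, by omega⟩) h)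
  have hu : Matrix.toEuclideanLin M u = (1 : ℝ) • u := by
    ext i
    simp [u, Matrix.mulVec, dotProduct, hM₁]
  have hw : inner ℝ u w = 0 := by simp [u, w, PiLp.inner_apply, hv]
  have hquad : inner ℝ w (Matrix.toEuclideanLin M w) = quadForm M v := by
    simp only [quadForm, PiLp.inner_apply, w, Matrix.toLpLin_apply, Matrix.mulVec, dotProduct,
      RCLike.inner_apply, conj_trivial, Finset.sum_mul]
    exact Finset.sum_congr rfl fun i _ => Finset.sum_congr rfl fun j _ => by ring
  have hnorm : ‖w‖ ^ 2 = ∑ i, v i ^ 2 := by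
    simp only [EuclideanSpace.norm_sq_eq, w, Real.norm_eq_abs, sq_abs]
  rw [← hquad, ← hnorm]
  exact inner_apply_self_le_second_eigenvalue (Matrix.isSymmetric_toEuclideanLin_iff.mpr hM)
    finrank_euclideanSpace rfl hu₀ hu hlt hw

theorem quadForm_le_lambda2_mul {κ : Type*} [Fintype κ] {y : Fin m → EuclideanSpace ℝ κ}
    (hy : ∑ i, y i = 0) : quadForm M y ≤ lambda2 hm hM * ∑ i, ‖y i‖ ^ 2 := by
  have coord_le (k : κ) : quadForm M (y · k) ≤ lambda2 hm hM * ∑ i, y i k ^ 2 :=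
    quadForm_le_lambda2_mul_of_real hm hM hM₁ hlt (by
      simpa using congrArg (fun w : EuclideanSpace ℝ κ => w k) hy)
  calc quadForm M y = ∑ k, quadForm M (y · k) := by
        simp only [quadForm, PiLp.inner_apply, Finset.mul_sum]
        rw [Finset.sum_comm]
        simp only [Finset.sum_comm (s := (Finset.univ : Finset κ))]
        rw [Finset.sum_comm]
    _ ≤ ∑ k, lambda2 hm hM * ∑ i, y i k ^ 2 := Finset.sum_le_sum fun k _ => coord_le k
    _ = lambda2 hm hM * ∑ i, ‖y i‖ ^ 2 := by
        rw [← Finset.mul_sum, Finset.sum_comm]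
        simp only [EuclideanSpace.norm_sq_eq, Real.norm_eq_abs, sq_abs]

end Spectral

section LipschitzGradient

variable {E : Type*} [NormedAddCommGroup E] {K : ℝ≥0} {Ω : Type*} {mΩ : MeasurableSpace Ω}
  {P : Measure Ω} [IsFiniteMeasure P] {X : Ω → E}

theorem memLp_comp_lipschitz {F : Type*} [NormedAddCommGroup F] {g : E → F}
    (hg : LipschitzWith K g) {p : ENNReal} (hX : MemLp X p P) : MemLp (fun ω => g (X ω)) p P := by
  have hlip : LipschitzWith K fun x => g x - g 0 := by
    simpa using hg.sub (LipschitzWith.const (g 0))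
  exact ((hlip.comp_memLp (sub_self _) hX).add (memLp_const (g 0))).ae_eq
    (ae_of_all _ fun ω => sub_add_cancel (g (X ω)) (g 0))

variable [InnerProductSpace ℝ E] [CompleteSpace E] {f : E → ℝ} {f' : E → E}

theorem abs_sub_inner_le (hf : ∀ x, HasGradientAt f (f' x) x) (hf' : LipschitzWith K f')
    (x y : E) : |f y - f x - inner ℝ (f' x) (y - x)| ≤ K * ‖y - x‖ ^ 2 := by
  have deriv_sub_le : ∀ z ∈ Metric.closedBall x ‖y - x‖,
      ‖InnerProductSpace.toDual ℝ E (f' z) - InnerProductSpace.toDual ℝ E (f' x)‖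
        ≤ K * ‖y - x‖ := fun z hz => by
    rw [← map_sub, LinearIsometryEquiv.norm_map]
    exact (hf'.norm_sub_le z x).trans (by gcongr; exact mem_closedBall_iff_norm.1 hz)
  have h := (convex_closedBall x ‖y - x‖).norm_image_sub_le_of_norm_hasFDerivWithin_le'
    (fun z _ => (hf z).hasFDerivAt.hasFDerivWithinAt) deriv_sub_le
    (Metric.mem_closedBall_self (norm_nonneg _)) (mem_closedBall_iff_norm.2 le_rfl)
  rwa [InnerProductSpace.toDual_apply_apply, Real.norm_eq_abs, mul_assoc, ← pow_two] at h

theorem integrable_comp_of_hasGradientAt (hf : ∀ x, HasGradientAt f (f' x) x)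
    (hf' : LipschitzWith K f') (hX : MemLp X 2 P) : Integrable (fun ω => f (X ω)) P := by
  have hcont : Continuous f := continuous_iff_continuousAt.2 fun x => (hf x).continuousAt
  refine (((integrable_const |f 0|).add ((hX.integrable one_le_two).norm.const_mul ‖f' 0‖)).add
    ((hX.integrable_norm_pow two_ne_zero).const_mul (K : ℝ))).mono'
    (hcont.comp_aestronglyMeasurable hX.1) (ae_of_all _ fun ω => ?_)
  have h := abs_sub_inner_le hf hf' 0 (X ω)
  rw [sub_zero] at h
  calc |f (X ω)| = |f 0 + inner ℝ (f' 0) (X ω) + (f (X ω) - f 0 - inner ℝ (f' 0) (X ω))| := by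
        ring_nf
    _ ≤ |f 0| + |inner ℝ (f' 0) (X ω)| + |f (X ω) - f 0 - inner ℝ (f' 0) (X ω)| :=
        abs_add_three _ _ _
    _ ≤ |f 0| + ‖f' 0‖ * ‖X ω‖ + K * ‖X ω‖ ^ 2 := by
        gcongr
        exact abs_real_inner_le_norm _ _

end LipschitzGradient

section Loss

variable {d : ℕ} {Z : Type*} [MeasurableSpace Z]

/-- A loss that is measurable in the sample, differentiable in the model, and whose gradient is
`K`-Lipschitz in the model uniformly in the sample. -/
structure SmoothLoss (K : ℝ≥0) (ℓ : EuclideanSpace ℝ (Fin d) → Z → ℝ) : Prop where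
  measurable (x) : Measurable (ℓ x)
  differentiable (z) : Differentiable ℝ fun x => ℓ x z
  lipschitz (z) : LipschitzWith K (stochGrad ℓ z)

namespace SmoothLoss

variable {K : ℝ≥0} {ℓ : EuclideanSpace ℝ (Fin d) → Z → ℝ} (hℓ : SmoothLoss K ℓ)
include hℓ

theorem abs_sub_inner_stochGrad_le (x y : EuclideanSpace ℝ (Fin d)) (z : Z) :
    |ℓ y z - ℓ x z - inner ℝ (stochGrad ℓ z x) (y - x)| ≤ K * ‖y - x‖ ^ 2 :=
  abs_sub_inner_le (fun x => (hℓ.differentiable z x).hasGradientAt) (hℓ.lipschitz z) x y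

theorem measurable_inner_stochGrad (x v : EuclideanSpace ℝ (Fin d)) :
    Measurable fun z => inner ℝ (stochGrad ℓ z x) v := by
  refine measurable_of_tendsto_metrizable
    (f := fun (n : ℕ) z => (n : ℝ) • (ℓ (x + (n : ℝ)⁻¹ • v) z - ℓ x z))
    (fun n => ((hℓ.measurable _).sub (hℓ.measurable _)).const_smul (n : ℝ))
    (tendsto_pi_nhds.2 fun z => ?_)
  exact (hℓ.differentiable z x).hasGradientAt.hasFDerivAt.lim v
    (by simpa using tendsto_natCast_atTop_atTop (R := ℝ))

theorem measurable_stochGrad_apply (x : EuclideanSpace ℝ (Fin d)) (k : Fin d) :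
    Measurable fun z => stochGrad ℓ z x k := by
  simpa [EuclideanSpace.inner_single_right] using
    hℓ.measurable_inner_stochGrad x (EuclideanSpace.single k 1)

theorem measurable_stochGrad : Measurable fun p : EuclideanSpace ℝ (Fin d) × Z =>
    stochGrad ℓ p.2 p.1 :=
  measurable_uncurry_of_continuous_of_measurable (u := fun x z => stochGrad ℓ z x)
    (fun z => (hℓ.lipschitz z).continuous)
    (fun x => (PiLp.continuous_toLp 2 _).measurable.comp
      (measurable_pi_lambda _ (hℓ.measurable_stochGrad_apply x)))

variable {D : Measure Z} [IsProbabilityMeasure D] (hint : ∀ x, Integrable (ℓ x) D)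
include hint

theorem integrable_stochGrad (x : EuclideanSpace ℝ (Fin d)) :
    Integrable (fun z => stochGrad ℓ z x) D := by
  refine Integrable.of_eval_piLp fun k => ?_
  set v : EuclideanSpace ℝ (Fin d) := EuclideanSpace.single k 1
  refine (((hint (x + v)).sub (hint x)).abs.add (integrable_const (K * ‖v‖ ^ 2))).mono'
    (hℓ.measurable_stochGrad_apply x k).aestronglyMeasurable (ae_of_all _ fun z => ?_)
  have coord : inner ℝ (stochGrad ℓ z x) v = stochGrad ℓ z x k := by
    simp [v, EuclideanSpace.inner_single_right]
  have h := hℓ.abs_sub_inner_stochGrad_le x (x + v) z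
  rw [add_sub_cancel_left, coord, abs_sub_comm] at h
  simp only [Real.norm_eq_abs, Pi.add_apply, Pi.sub_apply]
  linarith [abs_sub_abs_le_abs_sub (stochGrad ℓ z x k) (ℓ (x + v) z - ℓ x z)]

theorem hasGradientAt_localObjective (x : EuclideanSpace ℝ (Fin d)) :
    HasGradientAt (localObjective ℓ D) (∫ z, stochGrad ℓ z x ∂D) x := by
  have hgrad := hℓ.integrable_stochGrad hint x
  have remainder_le : ∀ y, ‖localObjective ℓ D y - localObjective ℓ D x
      - inner ℝ (∫ z, stochGrad ℓ z x ∂D) (y - x)‖ ≤ K * ‖‖y - x‖ ^ 2‖ := fun y => by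
    have hinner : inner ℝ (∫ z, stochGrad ℓ z x ∂D) (y - x)
        = ∫ z, inner ℝ (stochGrad ℓ z x) (y - x) ∂D := by
      simp only [real_inner_comm (y - x), integral_inner hgrad]
    rw [hinner, localObjective, localObjective, ← integral_sub (hint y) (hint x),
      ← integral_sub (f := fun z => ℓ y z - ℓ x z) ((hint y).sub (hint x))
        (hgrad.inner_const (𝕜 := ℝ) (y - x))]
    simpa using norm_integral_le_of_norm_le_const (μ := D) (ae_of_all _ fun z =>
      (Real.norm_eq_abs _).trans_le (hℓ.abs_sub_inner_stochGrad_le x y z))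
  rw [hasGradientAt_iff_isLittleO]
  refine (Asymptotics.IsBigO.of_bound K (Filter.Eventually.of_forall remainder_le)).trans_isLittleO
    ((Asymptotics.isLittleO_norm_pow_id one_lt_two).comp_tendsto ?_)
  simpa using (continuous_sub_right x).tendsto x

theorem lipschitzWith_gradient_localObjective : LipschitzWith K (∇ (localObjective ℓ D)) := by
  refine LipschitzWith.of_dist_le_mul fun x y => ?_
  rw [(hℓ.hasGradientAt_localObjective hint x).gradient,
    (hℓ.hasGradientAt_localObjective hint y).gradient, dist_eq_norm, dist_eq_norm,
    ← integral_sub (hℓ.integrable_stochGrad hint x) (hℓ.integrable_stochGrad hint y)]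
  simpa using norm_integral_le_of_norm_le_const (μ := D)
    (ae_of_all _ fun z => (hℓ.lipschitz z).norm_sub_le x y)

end SmoothLoss

theorem hasGradientAt_globalObjective {m : ℕ} {Ξ : Fin m → Type*} [∀ i, MeasurableSpace (Ξ i)]
    {ℓ : (i : Fin m) → EuclideanSpace ℝ (Fin d) → Ξ i → ℝ} {D : (i : Fin m) → Measure (Ξ i)}
    {x : EuclideanSpace ℝ (Fin d)} (h : ∀ i, DifferentiableAt ℝ (localObjective (ℓ i) (D i)) x) :
    HasGradientAt (globalObjective ℓ D) (mean fun i => ∇ (localObjective (ℓ i) (D i)) x) x := by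
  have toDual_mean : InnerProductSpace.toDual ℝ _ (mean fun i => ∇ (localObjective (ℓ i) (D i)) x)
      = (1 / (m : ℝ)) • ∑ i, InnerProductSpace.toDual ℝ _ (∇ (localObjective (ℓ i) (D i)) x) := by
    simp [mean, map_sum]
  rw [hasGradientAt_iff_hasFDerivAt, toDual_mean]
  exact (HasFDerivAt.fun_sum fun i (_ : i ∈ Finset.univ) =>
    (h i).hasGradientAt.hasFDerivAt).const_mul _

end Loss

section CondExp

variable {Ω : Type*} {𝓖 mΩ : MeasurableSpace Ω} {P : Measure Ω}

theorem setLIntegral_ofReal_le_of_condExp_le [IsFiniteMeasure P] (h𝓖 : 𝓖 ≤ mΩ) {f : Ω → ℝ}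
    (hf : Integrable f P) (hf₀ : ∀ ω, 0 ≤ f ω) {C : ℝ} (hC : P[f | 𝓖] ≤ᵐ[P] fun _ => C)
    {B : Set Ω} (hB : MeasurableSet[𝓖] B) :
    ∫⁻ ω in B, ENNReal.ofReal (f ω) ∂P ≤ ENNReal.ofReal C * P B := by
  have setIntegral_le : ∫ ω in B, (P[f | 𝓖]) ω ∂P ≤ C * P.real B :=
    (setIntegral_mono_ae integrable_condExp.integrableOn (integrable_const C).integrableOn
      hC).trans_eq (by simp [mul_comm])
  rw [← ofReal_integral_eq_lintegral_ofReal hf.integrableOn (ae_of_all _ hf₀),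
    ← setIntegral_condExp h𝓖 hf hB, ← ofReal_measureReal, ← ENNReal.ofReal_mul' measureReal_nonneg]
  exact ENNReal.ofReal_le_ofReal setIntegral_le

variable {V : Type*}

theorem exists_simpleFunc_tendsto [TopologicalSpace V] (h𝓖 : 𝓖 ≤ mΩ) {X : Ω → V}
    (hX : StronglyMeasurable[𝓖] X) :
    ∃ S : ℕ → SimpleFunc Ω V, (∀ n x, MeasurableSet[𝓖] (S n ⁻¹' {x})) ∧
      ∀ ω, Filter.Tendsto (fun n => S n ω) Filter.atTop (nhds (X ω)) :=
  have hfiber n := @SimpleFunc.measurableSet_fiber Ω V 𝓖 (hX.approx n)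
  ⟨fun n => ⟨hX.approx n, fun x => h𝓖 _ (hfiber n x),
    @SimpleFunc.finite_range Ω V 𝓖 (hX.approx n)⟩, hfiber, hX.tendsto_approx⟩

variable {φ : V → Ω → ENNReal} {C : ENNReal}

theorem lintegral_comp_simpleFunc_le (h𝓖 : 𝓖 ≤ mΩ)
    (hφ : ∀ x B, MeasurableSet[𝓖] B → ∫⁻ ω in B, φ x ω ∂P ≤ C * P B) {S : SimpleFunc Ω V}
    (hS : ∀ x, MeasurableSet[𝓖] (S ⁻¹' {x})) : ∫⁻ ω, φ (S ω) ω ∂P ≤ C * P Set.univ := by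
  have hcover : ⋃ x ∈ S.range, S ⁻¹' {x} = Set.univ := by
    ext ω
    simp
  have hdisj : (S.range : Set V).PairwiseDisjoint fun x => S ⁻¹' {x} :=
    fun _ _ _ _ hxy => (Set.disjoint_singleton.2 hxy).preimage S
  calc ∫⁻ ω, φ (S ω) ω ∂P = ∑ x ∈ S.range, ∫⁻ ω in S ⁻¹' {x}, φ (S ω) ω ∂P := by
        rw [← lintegral_biUnion_finset hdisj fun x _ => h𝓖 _ (hS x), hcover,
          Measure.restrict_univ]
    _ = ∑ x ∈ S.range, ∫⁻ ω in S ⁻¹' {x}, φ x ω ∂P :=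
        Finset.sum_congr rfl fun x _ => setLIntegral_congr_fun (h𝓖 _ (hS x)) fun ω hω =>
          congrArg (φ · ω) hω
    _ ≤ ∑ x ∈ S.range, C * P (S ⁻¹' {x}) := Finset.sum_le_sum fun x _ => hφ x _ (hS x)
    _ = C * P Set.univ := by
        rw [← Finset.mul_sum, ← measure_biUnion_finset hdisj fun x _ => h𝓖 _ (hS x), hcover]

theorem lintegral_comp_le [TopologicalSpace V] (h𝓖 : 𝓖 ≤ mΩ) (hcont : ∀ ω, Continuous (φ · ω))
    (hmeas : ∀ x, Measurable (φ x))
    (hφ : ∀ x B, MeasurableSet[𝓖] B → ∫⁻ ω in B, φ x ω ∂P ≤ C * P B) {X : Ω → V}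
    (hX : StronglyMeasurable[𝓖] X) : ∫⁻ ω, φ (X ω) ω ∂P ≤ C * P Set.univ := by
  obtain ⟨S, hS, hlim⟩ := exists_simpleFunc_tendsto h𝓖 hX
  calc ∫⁻ ω, φ (X ω) ω ∂P
      = ∫⁻ ω, Filter.liminf (fun n => φ (S n ω) ω) Filter.atTop ∂P :=
        lintegral_congr fun ω => (((hcont ω).tendsto _).comp (hlim ω)).liminf_eq.symm
    _ ≤ Filter.liminf (fun n => ∫⁻ ω, φ (S n ω) ω ∂P) Filter.atTop :=
        lintegral_liminf_le fun n => (S n).measurable_bind φ hmeas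
    _ ≤ Filter.liminf (fun _ : ℕ => C * P Set.univ) Filter.atTop :=
        Filter.liminf_le_liminf (Filter.Eventually.of_forall fun n =>
          lintegral_comp_simpleFunc_le h𝓖 hφ (hS n))
    _ = C * P Set.univ := Filter.liminf_const _

theorem lintegral_comp_le_of_condExp_le [IsProbabilityMeasure P] [TopologicalSpace V]
    (h𝓖 : 𝓖 ≤ mΩ) {f : V → Ω → ℝ} (hcont : ∀ ω, Continuous (f · ω)) (hf₀ : ∀ x ω, 0 ≤ f x ω)
    (hint : ∀ x, Integrable (f x) P) (hmeas : ∀ x, Measurable (f x)) {c : ℝ}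
    (hc : ∀ x, P[f x | 𝓖] ≤ᵐ[P] fun _ => c) {X : Ω → V} (hX : StronglyMeasurable[𝓖] X) :
    ∫⁻ ω, ENNReal.ofReal (f (X ω) ω) ∂P ≤ ENNReal.ofReal c := by
  simpa using lintegral_comp_le h𝓖 (φ := fun x ω => ENNReal.ofReal (f x ω))
    (fun ω => ENNReal.continuous_ofReal.comp (hcont ω)) (fun x => (hmeas x).ennreal_ofReal)
    (fun x _ hB => setLIntegral_ofReal_le_of_condExp_le h𝓖 (hint x) (hf₀ x) (hc x) hB) hX

variable [NormedAddCommGroup V] [InnerProductSpace ℝ V]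

theorem integrable_inner_of_memLp {f g : Ω → V} (hf : MemLp f 2 P) (hg : MemLp g 2 P) :
    Integrable (fun ω => inner ℝ (f ω) (g ω)) P :=
  (hf.norm.integrable_mul hg.norm).mono' (hf.1.inner hg.1)
    (ae_of_all _ fun _ => norm_inner_le_norm _ _)

variable [IsFiniteMeasure P] [CompleteSpace V]

theorem integral_inner_eq_of_condExp (h𝓖 : 𝓖 ≤ mΩ) {φ g h : Ω → V}
    (hφm : StronglyMeasurable[𝓖] φ) (hφ : MemLp φ 2 P) (hg : MemLp g 2 P)
    (hgh : P[g | 𝓖] =ᵐ[P] h) :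
    ∫ ω, inner ℝ (φ ω) (g ω) ∂P = ∫ ω, inner ℝ (φ ω) (h ω) ∂P := by
  rw [← integral_condExp h𝓖]
  refine integral_congr_ae ((condExp_bilin_of_stronglyMeasurable_left (innerSL ℝ) hφm
    (integrable_inner_of_memLp hφ hg) (hg.integrable one_le_two)).trans ?_)
  filter_upwards [hgh] with ω hω
  rw [hω, innerSL_apply_apply]

end CondExp

section Descent

variable {ι : Type*} [Fintype ι] {E : Type*} [NormedAddCommGroup E] [InnerProductSpace ℝ E]

theorem neg_inner_le_of_pos {s : ℝ} (hs : 0 < s) (a b : E) :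
    -inner ℝ a b ≤ s / 8 * ‖a‖ ^ 2 + 2 / s * ‖b‖ ^ 2 := by
  have defect : s / 8 * ‖a‖ ^ 2 + 2 / s * ‖b‖ ^ 2 - ‖a‖ * ‖b‖
      = 1 / (8 * s) * (s * ‖a‖ - 4 * ‖b‖) ^ 2 := by
    field_simp
    ring
  calc -inner ℝ a b ≤ ‖a‖ * ‖b‖ := by linarith [(abs_le.1 (abs_real_inner_le_norm a b)).1]
    _ ≤ s / 8 * ‖a‖ ^ 2 + 2 / s * ‖b‖ ^ 2 := by
      rw [← sub_nonneg, defect]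
      positivity

theorem apply_sub_smul_le [CompleteSpace E] {F : E → ℝ} {F' : E → E} {K : ℝ≥0}
    (hF : ∀ x, HasGradientAt F (F' x) x) (hF' : LipschitzWith K F') (x v : E) (η : ℝ) :
    F (x - η • v) ≤ F x - η * inner ℝ (F' x) v + K * η ^ 2 * ‖v‖ ^ 2 := by
  have h := (abs_le.1 (abs_sub_inner_le hF hF' x (x - η • v))).2
  rw [sub_sub_cancel_left, inner_neg_right, real_inner_smul_right, norm_neg, norm_smul,
    mul_pow, Real.norm_eq_abs, sq_abs] at h
  linarith

variable [Nonempty ι]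

theorem apply_sub_smul_mean_le [CompleteSpace E] {F : E → ℝ} {F' : E → E} {K : ℝ≥0}
    (hF : ∀ x, HasGradientAt F (F' x) x) (hF' : LipschitzWith K F') {η s δ : ℝ} (hη : 0 ≤ η)
    (hs : 0 < s) {g G : ι → E} (hG : ∀ i, ‖G i - s • g i‖ ≤ δ * ‖g i‖) (x : E) :
    F (x - η • mean G) ≤ F x - η * s * inner ℝ (F' x) (mean g) + η * s / 8 * ‖F' x‖ ^ 2
      + (2 * η / s * δ ^ 2 + K * η ^ 2 * (s + δ) ^ 2) * avgSq g := by
  have mean_le : ‖mean G‖ ^ 2 ≤ (s + δ) ^ 2 * avgSq g := (norm_mean_sq_le_avgSq G).trans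
    (avgSq_le_sq_mul_avgSq fun i => norm_le_of_norm_sub_smul_le hs.le (hG i))
  have drift_le : ‖mean G - s • mean g‖ ^ 2 ≤ δ ^ 2 * avgSq g := by
    rw [← mean_smul, ← mean_sub]
    exact (norm_mean_sq_le_avgSq _).trans (avgSq_le_sq_mul_avgSq hG)
  have inner_eq : inner ℝ (F' x) (mean G)
      = s * inner ℝ (F' x) (mean g) + inner ℝ (F' x) (mean G - s • mean g) := by
    rw [inner_sub_right, real_inner_smul_right]
    ring
  calc F (x - η • mean G)
      ≤ F x - η * inner ℝ (F' x) (mean G) + K * η ^ 2 * ‖mean G‖ ^ 2 :=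
        apply_sub_smul_le hF hF' x _ η
    _ = F x - η * s * inner ℝ (F' x) (mean g) + η * -inner ℝ (F' x) (mean G - s • mean g)
          + K * η ^ 2 * ‖mean G‖ ^ 2 := by rw [inner_eq]; ring
    _ ≤ F x - η * s * inner ℝ (F' x) (mean g)
          + η * (s / 8 * ‖F' x‖ ^ 2 + 2 / s * (δ ^ 2 * avgSq g))
          + K * η ^ 2 * ((s + δ) ^ 2 * avgSq g) := by
        gcongr
        exact (neg_inner_le_of_pos hs _ _).trans (by gcongr)
    _ = _ := by ring

theorem spread_sub_smul_le {r : ℝ} (hr₀ : 0 ≤ r) (hr₁ : r < 1) {η s δ : ℝ} (hs : 0 ≤ s)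
    {g G : ι → E} (hG : ∀ i, ‖G i - s • g i‖ ≤ δ * ‖g i‖) (x : ι → E) :
    r ^ 2 * spread (fun i => x i - η • G i)
      ≤ r * spread x + 1 / (1 - r) * (η ^ 2 * (s + δ) ^ 2) * avgSq g := by
  have : 0 < 1 - r := sub_pos.2 hr₁
  calc r ^ 2 * spread (fun i => x i - η • G i)
      ≤ r * spread x + 1 / (1 - r) * avgSq (fun i => η • G i) := sq_mul_spread_sub_le hr₀ hr₁ x _
    _ ≤ r * spread x + 1 / (1 - r) * (η ^ 2 * ((s + δ) ^ 2 * avgSq g)) := by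
        rw [avgSq_smul]
        gcongr
        exact avgSq_le_sq_mul_avgSq fun i => norm_le_of_norm_sub_smul_le hs (hG i)
    _ = _ := by ring

variable {K : ℝ≥0} {H : ι → E → E}

omit [Nonempty ι] in
theorem avgSq_comp_sub_le (hH : ∀ i, LipschitzWith K (H i)) (x : ι → E) :
    avgSq (fun i => H i (x i) - H i (mean x)) ≤ K ^ 2 * spread x :=
  avgSq_le_sq_mul_avgSq fun i => (hH i).norm_sub_le _ _

theorem avgSq_comp_le (hH : ∀ i, LipschitzWith K (H i)) {β ζ : ℝ}
    (hdis : ∀ x, spread (H · x) ≤ β ^ 2 * ‖mean (H · x)‖ ^ 2 + ζ ^ 2) (x : ι → E) :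
    avgSq (fun i => H i (x i))
      ≤ 2 * K ^ 2 * spread x + 2 * (β ^ 2 + 1) * ‖mean (H · (mean x))‖ ^ 2 + 2 * ζ ^ 2 := by
  have split := avgSq_add_le (fun i => H i (x i) - H i (mean x)) (H · (mean x))
  simp only [sub_add_cancel] at split
  linarith [avgSq_comp_sub_le hH x, hdis (mean x), spread_eq_avgSq_sub (H · (mean x))]

theorem neg_inner_mean_comp_le (hH : ∀ i, LipschitzWith K (H i)) (x : ι → E) :
    -inner ℝ (mean (H · (mean x))) (mean fun i => H i (x i))
      ≤ -(1 / 2) * ‖mean (H · (mean x))‖ ^ 2 + K ^ 2 / 2 * spread x := by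
  have h := (norm_mean_sq_le_avgSq _).trans (avgSq_comp_sub_le hH x)
  rw [mean_sub, norm_sub_sq_real, real_inner_comm] at h
  linarith [sq_nonneg ‖mean fun i => H i (x i)‖]

end Descent

section StochasticGradients

variable {Ω : Type*} {𝓖 mΩ : MeasurableSpace Ω} {P : Measure Ω}
  {E : Type*} [NormedAddCommGroup E] [InnerProductSpace ℝ E] [CompleteSpace E]

theorem integral_norm_sq_eq_of_condExp [IsFiniteMeasure P] (h𝓖 : 𝓖 ≤ mΩ) {g h : Ω → E}
    (hg : MemLp g 2 P) (hh : MemLp h 2 P) (hhm : StronglyMeasurable[𝓖] h)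
    (hgh : P[g | 𝓖] =ᵐ[P] h) :
    ∫ ω, ‖g ω‖ ^ 2 ∂P = ∫ ω, ‖g ω - h ω‖ ^ 2 ∂P + ∫ ω, ‖h ω‖ ^ 2 ∂P := by
  have expand : ∀ ω, ‖g ω‖ ^ 2 = ‖g ω - h ω‖ ^ 2 + 2 * inner ℝ (h ω) (g ω) - ‖h ω‖ ^ 2 :=
    fun ω => by
      rw [norm_sub_sq_real, real_inner_comm]
      ring
  have hsub : Integrable (fun ω => ‖g ω - h ω‖ ^ 2) P :=
    (hg.sub hh).integrable_norm_pow two_ne_zero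
  have hinner := (integrable_inner_of_memLp hh hg).const_mul 2
  have cross := integral_inner_eq_of_condExp h𝓖 hhm hh hg hgh
  simp only [real_inner_self_eq_norm_sq] at cross
  simp only [expand]
  rw [integral_sub (f := fun ω => ‖g ω - h ω‖ ^ 2 + 2 * inner ℝ (h ω) (g ω))
    (hsub.add hinner) (hh.integrable_norm_pow two_ne_zero),
    integral_add hsub hinner, integral_const_mul, cross]
  ring

omit [CompleteSpace E] in
theorem integral_spread_sub_smul_le {ι : Type*} [Fintype ι] [Nonempty ι] {X g G : ι → Ω → E}
    (hX : ∀ i, MemLp (X i) 2 P) (hg : ∀ i, MemLp (g i) 2 P) (hG : ∀ i, MemLp (G i) 2 P)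
    {r : ℝ} (hr₀ : 0 ≤ r) (hr₁ : r < 1) {η s δ : ℝ} (hs : 0 ≤ s)
    (hgG : ∀ i ω, ‖G i ω - s • g i ω‖ ≤ δ * ‖g i ω‖) :
    r ^ 2 * ∫ ω, spread (fun i => X i ω - η • G i ω) ∂P
      ≤ r * ∫ ω, spread (X · ω) ∂P
        + 1 / (1 - r) * (η ^ 2 * (s + δ) ^ 2) * ∫ ω, avgSq (g · ω) ∂P := by
  have hspread := (integrable_spread hX).const_mul r
  have havg := (integrable_avgSq hg).const_mul (1 / (1 - r) * (η ^ 2 * (s + δ) ^ 2))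
  have hstep : Integrable (fun ω => spread fun i => X i ω - η • G i ω) P :=
    integrable_spread (X := fun i ω => X i ω - η • G i ω) fun i => (hX i).sub ((hG i).const_smul η)
  rw [← integral_const_mul, ← integral_const_mul, ← integral_const_mul,
    ← integral_add hspread havg]
  exact integral_mono (hstep.const_mul _) (hspread.add havg)
    fun ω => spread_sub_smul_le hr₀ hr₁ hs (hgG · ω) (X · ω)

variable {ι : Type*}

/-- Square-integrable random points `X i` with stochastic gradients `g i` that, given the
information `𝓖` by which the points are known, have mean `H i (X i)`. -/
structure UnbiasedGradients (P : Measure Ω) (𝓖 : MeasurableSpace Ω) (H : ι → E → E)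
    (X g : ι → Ω → E) : Prop where
  stronglyMeasurable (i) : StronglyMeasurable[𝓖] (X i)
  memLp_point (i) : MemLp (X i) 2 P
  memLp_grad (i) : MemLp (g i) 2 P
  condExp_grad (i) : P[g i | 𝓖] =ᵐ[P] fun ω => H i (X i ω)

namespace UnbiasedGradients

variable [Fintype ι] [Nonempty ι] [IsProbabilityMeasure P] {H : ι → E → E} {X g : ι → Ω → E}
  (hg : UnbiasedGradients P 𝓖 H X g) (h𝓖 : 𝓖 ≤ mΩ) {K : ℝ≥0} (hH : ∀ i, LipschitzWith K (H i))
include hg h𝓖 hH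

omit [Nonempty ι] in
theorem integral_avgSq_eq : ∫ ω, avgSq (g · ω) ∂P
    = ∫ ω, avgSq (fun i => g i ω - H i (X i ω)) ∂P
      + ∫ ω, avgSq (fun i => H i (X i ω)) ∂P := by
  have hHX i := memLp_comp_lipschitz (hH i) (hg.memLp_point i)
  simp only [avgSq]
  rw [integral_mean fun i => (hg.memLp_grad i).integrable_norm_pow two_ne_zero,
    integral_mean (X := fun i ω => ‖g i ω - H i (X i ω)‖ ^ 2) fun i =>
      ((hg.memLp_grad i).sub (hHX i)).integrable_norm_pow two_ne_zero,
    integral_mean (X := fun i ω => ‖H i (X i ω)‖ ^ 2) fun i =>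
      (hHX i).integrable_norm_pow two_ne_zero, ← mean_add]
  exact congrArg mean (funext fun i => integral_norm_sq_eq_of_condExp h𝓖 (hg.memLp_grad i)
    (hHX i) ((hH i).continuous.comp_stronglyMeasurable (hg.stronglyMeasurable i))
    (hg.condExp_grad i))

theorem integral_avgSq_le {σ β ζ : ℝ}
    (hvar : ∀ i, ∫ ω, ‖g i ω - H i (X i ω)‖ ^ 2 ∂P ≤ σ ^ 2)
    (hdis : ∀ x, spread (H · x) ≤ β ^ 2 * ‖mean (H · x)‖ ^ 2 + ζ ^ 2) :
    ∫ ω, avgSq (g · ω) ∂P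
      ≤ σ ^ 2 + (2 * K ^ 2 * ∫ ω, spread (X · ω) ∂P
        + 2 * (β ^ 2 + 1) * ∫ ω, ‖mean (H · (mean (X · ω)))‖ ^ 2 ∂P + 2 * ζ ^ 2) := by
  have hHX i := memLp_comp_lipschitz (hH i) (hg.memLp_point i)
  have hspread := (integrable_spread hg.memLp_point).const_mul (2 * (K : ℝ) ^ 2)
  have hgrad := ((memLp_comp_lipschitz (lipschitzWith_mean hH)
    (memLp_mean hg.memLp_point)).integrable_norm_pow two_ne_zero).const_mul (2 * (β ^ 2 + 1))
  rw [hg.integral_avgSq_eq h𝓖 hH]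
  gcongr
  · simp only [avgSq]
    rw [integral_mean (X := fun i ω => ‖g i ω - H i (X i ω)‖ ^ 2) fun i =>
      ((hg.memLp_grad i).sub (hHX i)).integrable_norm_pow two_ne_zero]
    exact (mean_le_mean hvar).trans_eq (mean_const _)
  · refine (integral_mono (integrable_avgSq hHX)
      ((hspread.add hgrad).add (integrable_const (2 * ζ ^ 2)))
      fun ω => avgSq_comp_le hH hdis (X · ω)).trans_eq ?_
    rw [integral_add' (hspread.add hgrad) (integrable_const _), integral_add' hspread hgrad,
      integral_const_mul, integral_const_mul, integral_const, probReal_univ, one_smul]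

theorem integral_inner_mean_eq :
    ∫ ω, inner ℝ (mean (H · (mean (X · ω)))) (mean (g · ω)) ∂P
      = ∫ ω, inner ℝ (mean (H · (mean (X · ω)))) (mean fun i => H i (X i ω)) ∂P := by
  have hmean := lipschitzWith_mean hH
  have hgrad := memLp_comp_lipschitz hmean (memLp_mean hg.memLp_point)
  have hgradm := hmean.continuous.comp_stronglyMeasurable
    (stronglyMeasurable_mean hg.stronglyMeasurable)
  simp only [inner_mean]
  rw [integral_mean fun i => integrable_inner_of_memLp hgrad (hg.memLp_grad i),
    integral_mean fun i => integrable_inner_of_memLp hgrad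
      (memLp_comp_lipschitz (hH i) (hg.memLp_point i))]
  exact congrArg mean (funext fun i => integral_inner_eq_of_condExp h𝓖 hgradm hgrad
    (hg.memLp_grad i) (hg.condExp_grad i))

/-- Averaging the cross term is where unbiasedness enters: only the gradients at the start of the
round are unbiased, so the local drift is left to the remainder of `apply_sub_smul_mean_le`. -/
theorem integral_comp_sub_smul_mean_le {F : E → ℝ} (hF : ∀ x, HasGradientAt F (mean (H · x)) x)
    {G : ι → Ω → E} (hGm : ∀ i, MemLp (G i) 2 P) {η s δ : ℝ} (hη : 0 ≤ η) (hs : 0 < s)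
    (hG : ∀ i ω, ‖G i ω - s • g i ω‖ ≤ δ * ‖g i ω‖) :
    ∫ ω, F (mean (X · ω) - η • mean (G · ω)) ∂P
      ≤ ∫ ω, F (mean (X · ω)) ∂P - 3 / 8 * (η * s) * ∫ ω, ‖mean (H · (mean (X · ω)))‖ ^ 2 ∂P
        + η * s / 2 * K ^ 2 * ∫ ω, spread (X · ω) ∂P
        + (2 * η / s * δ ^ 2 + K * η ^ 2 * (s + δ) ^ 2) * ∫ ω, avgSq (g · ω) ∂P := by
  have hmean := lipschitzWith_mean hH
  have hbar := memLp_mean hg.memLp_point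
  have hgrad := memLp_comp_lipschitz hmean hbar
  have hFX := integrable_comp_of_hasGradientAt hF hmean hbar
  have hcross := (integrable_inner_of_memLp hgrad (memLp_mean hg.memLp_grad)).const_mul (η * s)
  have hsq := hgrad.integrable_norm_pow two_ne_zero
  have havg := (integrable_avgSq hg.memLp_grad).const_mul
    (2 * η / s * δ ^ 2 + K * η ^ 2 * (s + δ) ^ 2)
  have descent := integral_mono
    (integrable_comp_of_hasGradientAt hF hmean (hbar.sub ((memLp_mean hGm).const_smul η)))
    (((hFX.sub hcross).add (hsq.const_mul (η * s / 8))).add havg)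
    fun ω => apply_sub_smul_mean_le hF hmean hη hs (hG · ω) (mean (X · ω))
  have alignment := integral_mono
    (integrable_inner_of_memLp hgrad (memLp_mean fun i =>
      memLp_comp_lipschitz (hH i) (hg.memLp_point i))).neg
    ((hsq.const_mul (-(1 / 2))).add
      ((integrable_spread hg.memLp_point).const_mul ((K : ℝ) ^ 2 / 2)))
    fun ω => neg_inner_mean_comp_le hH (X · ω)
  rw [integral_add' ((hFX.sub hcross).add (hsq.const_mul (η * s / 8))) havg,
    integral_add' (hFX.sub hcross) (hsq.const_mul (η * s / 8)), integral_sub' hFX hcross,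
    integral_const_mul, integral_const_mul, integral_const_mul,
    hg.integral_inner_mean_eq h𝓖 hH] at descent
  rw [integral_neg', integral_add' (hsq.const_mul (-(1 / 2)))
    ((integrable_spread hg.memLp_point).const_mul ((K : ℝ) ^ 2 / 2)), integral_const_mul,
    integral_const_mul] at alignment
  simp only [Pi.sub_apply, Pi.smul_apply] at descent
  linarith [mul_le_mul_of_nonneg_left alignment (mul_nonneg hη hs.le)]

end UnbiasedGradients

end StochasticGradients

section ConditionalVariance

variable {Ω : Type*} {𝓖 mΩ : MeasurableSpace Ω} {P : Measure Ω} {E : Type*}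
  [NormedAddCommGroup E]

theorem memLp_two_of_lintegral_norm_sq_le {f : Ω → E} (hf : AEStronglyMeasurable f P) {c : ℝ}
    (hc : ∫⁻ ω, ENNReal.ofReal (‖f ω‖ ^ 2) ∂P ≤ ENNReal.ofReal c) : MemLp f 2 P :=
  (memLp_two_iff_integrable_sq_norm hf).2 ⟨hf.norm.pow 2, by
    rw [hasFiniteIntegral_iff_ofReal (ae_of_all _ fun _ => by positivity)]
    exact hc.trans_lt ENNReal.ofReal_lt_top⟩

theorem integral_norm_sq_le_of_lintegral_le {f : Ω → E} (hf : AEStronglyMeasurable f P) {c : ℝ}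
    (hc₀ : 0 ≤ c) (hc : ∫⁻ ω, ENNReal.ofReal (‖f ω‖ ^ 2) ∂P ≤ ENNReal.ofReal c) :
    ∫ ω, ‖f ω‖ ^ 2 ∂P ≤ c := by
  rw [integral_eq_lintegral_of_nonneg_ae (f := fun ω => ‖f ω‖ ^ 2)
    (ae_of_all _ fun _ => by positivity) (hf.norm.pow 2)]
  exact ENNReal.toReal_le_of_le_ofReal hc₀ hc

/-- At every fixed point `x`, the random vector `g x` deviates from `h x` by at most `σ ^ 2` in
conditional mean square given `𝓖`. -/
def CondVarianceLE (P : Measure Ω) (𝓖 : MeasurableSpace Ω) (g : E → Ω → E) (h : E → E) (σ : ℝ) :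
    Prop :=
  ∀ x, Integrable (fun ω => ‖g x ω - h x‖ ^ 2) P ∧
    P[fun ω => ‖g x ω - h x‖ ^ 2 | 𝓖] ≤ᵐ[P] fun _ => σ ^ 2

namespace CondVarianceLE

variable [IsProbabilityMeasure P] {g : E → Ω → E} {h : E → E} {σ : ℝ}
  (hg : CondVarianceLE P 𝓖 g h σ) (h𝓖 : 𝓖 ≤ mΩ) (hcont : ∀ ω, Continuous (g · ω))
  (hh : Continuous h) (hmeas : ∀ x, StronglyMeasurable (g x)) {X : Ω → E}
  (hX : StronglyMeasurable[𝓖] X)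
include hg h𝓖 hcont hh hmeas hX

theorem lintegral_comp_le :
    ∫⁻ ω, ENNReal.ofReal (‖g (X ω) ω - h (X ω)‖ ^ 2) ∂P ≤ ENNReal.ofReal (σ ^ 2) :=
  lintegral_comp_le_of_condExp_le h𝓖 (f := fun x ω => ‖g x ω - h x‖ ^ 2)
    (fun ω => ((hcont ω).sub hh).norm.pow 2) (fun _ _ => by positivity) (fun x => (hg x).1)
    (fun x => (((hmeas x).sub stronglyMeasurable_const).norm.pow 2).measurable)
    (fun x => (hg x).2) hX

variable (hgX : AEStronglyMeasurable (fun ω => g (X ω) ω) P)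
include hgX

theorem memLp_comp_sub : MemLp (fun ω => g (X ω) ω - h (X ω)) 2 P :=
  memLp_two_of_lintegral_norm_sq_le
    (hgX.sub (hh.comp_stronglyMeasurable (hX.mono h𝓖)).aestronglyMeasurable)
    (hg.lintegral_comp_le h𝓖 hcont hh hmeas hX)

theorem integral_norm_sq_comp_sub_le : ∫ ω, ‖g (X ω) ω - h (X ω)‖ ^ 2 ∂P ≤ σ ^ 2 :=
  integral_norm_sq_le_of_lintegral_le
    (hgX.sub (hh.comp_stronglyMeasurable (hX.mono h𝓖)).aestronglyMeasurable) (sq_nonneg σ)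
    (hg.lintegral_comp_le h𝓖 hcont hh hmeas hX)

end CondVarianceLE

end ConditionalVariance

section RandomGossip

variable {m : ℕ} {Ω : Type*} {A : ℕ → Ω → Finset (Fin m)} {t : ℕ}

theorem measurable_comp_link {γ : Type*} [MeasurableSpace γ] (f : Finset (Fin m) → γ) (t : ℕ) :
    Measurable[linkSigma A t] fun ω => f (A t ω) :=
  (measurable_from_top (f := f)).comp (comap_measurable (A t))

variable {𝓗 mΩ : MeasurableSpace Ω} {P : Measure Ω} (hA : Measurable[_, ⊤] (A t))
include hA

theorem integrable_comp_link_mul {Z : Ω → ℝ} (hZ : Integrable Z P) (f : Finset (Fin m) → ℝ) :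
    Integrable (fun ω => f (A t ω) * Z ω) P := by
  obtain ⟨C, hC⟩ := (Set.finite_range fun S => ‖f S‖).bddAbove
  exact hZ.bdd_mul ((measurable_comp_link f t).mono hA.comap_le le_rfl).aestronglyMeasurable
    (ae_of_all _ fun ω => hC ⟨A t ω, rfl⟩)

theorem integral_comp_link_mul (h𝓗 : 𝓗 ≤ mΩ) (hind : Indep (linkSigma A t) 𝓗 P) {Z : Ω → ℝ}
    (hZ : StronglyMeasurable[𝓗] Z) (f : Finset (Fin m) → ℝ) :
    ∫ ω, f (A t ω) * Z ω ∂P = (∫ ω, f (A t ω) ∂P) * ∫ ω, Z ω ∂P := by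
  have hf := measurable_comp_link (A := A) f t
  have hfZ : IndepFun (fun ω => f (A t ω)) Z P :=
    (IndepFun_iff_Indep _ _ _).2 (indep_of_indep_of_le_left
      (indep_of_indep_of_le_right hind hZ.measurable.comap_le) hf.comap_le)
  exact hfZ.integral_fun_mul_eq_mul_integral (hf.mono hA.comap_le le_rfl).aestronglyMeasurable
    (hZ.mono h𝓗).aestronglyMeasurable

theorem sum_meanSqGossip [IsProbabilityMeasure P] (i : Fin m) :
    ∑ j, meanSqGossip P A t i j = 1 := by
  have hint j : Integrable (fun ω => (gossipMatrix (A t ω) ^ 2) i j) P := by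
    simpa using integrable_comp_link_mul hA (integrable_const (1 : ℝ))
      fun S => (gossipMatrix S ^ 2) i j
  simp only [meanSqGossip, Matrix.of_apply]
  rw [← integral_finsetSum _ fun j _ => hint j]
  simp [sum_gossipMatrix_sq]

theorem memLp_gossip {E : Type*} [NormedAddCommGroup E] [NormedSpace ℝ E] {Y : Fin m → Ω → E}
    {p : ENNReal} (hY : ∀ i, MemLp (Y i) p P) (i : Fin m) :
    MemLp (fun ω => gossip (A t ω) (Y · ω) i) p P := by
  refine memLp_finsetSum _ fun j _ => (hY j).mono
    (((measurable_comp_link (gossipMatrix · i j) t).mono hA.comap_le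
      le_rfl).aestronglyMeasurable.smul (hY j).1) (ae_of_all _ fun ω => ?_)
  rw [norm_smul, Real.norm_of_nonneg (gossipMatrix_nonneg _ _ _)]
  exact mul_le_of_le_one_left (norm_nonneg _) (gossipMatrix_le_one _ _ _)

variable {E : Type*} [NormedAddCommGroup E] [InnerProductSpace ℝ E] {Y : Fin m → Ω → E}

theorem integral_quadForm_gossipMatrix_sq (h𝓗 : 𝓗 ≤ mΩ) (hind : Indep (linkSigma A t) 𝓗 P)
    (hYm : ∀ i, StronglyMeasurable[𝓗] (Y i)) (hY : ∀ i, MemLp (Y i) 2 P) :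
    ∫ ω, quadForm (gossipMatrix (A t ω) ^ 2) (Y · ω) ∂P
      = ∫ ω, quadForm (meanSqGossip P A t) (Y · ω) ∂P := by
  have hinner i j := integrable_inner_of_memLp (hY i) (hY j)
  have hgossip i j := integrable_comp_link_mul hA (hinner i j) fun S => (gossipMatrix S ^ 2) i j
  have hmean i j := (hinner i j).const_mul (meanSqGossip P A t i j)
  simp only [quadForm]
  rw [integral_finsetSum _ fun i _ => integrable_finsetSum _ fun j _ => hgossip i j,
    integral_finsetSum _ fun i _ => integrable_finsetSum _ fun j _ => hmean i j]
  refine Finset.sum_congr rfl fun i _ => ?_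
  rw [integral_finsetSum _ fun j _ => hgossip i j, integral_finsetSum _ fun j _ => hmean i j]
  refine Finset.sum_congr rfl fun j _ => ?_
  rw [integral_const_mul]
  exact integral_comp_link_mul hA h𝓗 hind ((hYm i).inner (hYm j)) fun S => (gossipMatrix S ^ 2) i j

theorem integral_spread_gossip_le [IsProbabilityMeasure P] (hm : 2 ≤ m)
    (hlt : lambda2 hm (meanSqGossip_isHermitian P A t) < 1) (h𝓗 : 𝓗 ≤ mΩ)
    (hind : Indep (linkSigma A t) 𝓗 P) {κ : Type*} [Fintype κ]
    {Y : Fin m → Ω → EuclideanSpace ℝ κ}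
    (hYm : ∀ i, StronglyMeasurable[𝓗] (Y i)) (hY : ∀ i, MemLp (Y i) 2 P) :
    ∫ ω, spread (gossip (A t ω) (Y · ω)) ∂P
      ≤ lambda2 hm (meanSqGossip_isHermitian P A t) * ∫ ω, spread (Y · ω) ∂P := by
  have : Nonempty (Fin m) := ⟨⟨0, by omega⟩⟩
  have hZ i : MemLp (fun ω => Y i ω - mean (Y · ω)) 2 P := (hY i).sub (memLp_mean hY)
  have hZm i : StronglyMeasurable[𝓗] fun ω => Y i ω - mean (Y · ω) :=
    (hYm i).sub (stronglyMeasurable_mean hYm)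
  calc ∫ ω, spread (gossip (A t ω) (Y · ω)) ∂P
      = (m : ℝ)⁻¹ * ∫ ω, quadForm (meanSqGossip P A t) (fun i => Y i ω - mean (Y · ω)) ∂P := by
        simp only [spread_gossip]
        rw [integral_const_mul, integral_quadForm_gossipMatrix_sq hA h𝓗 hind hZm hZ]
    _ ≤ (m : ℝ)⁻¹ * ∫ ω, lambda2 hm (meanSqGossip_isHermitian P A t)
          * ∑ i, ‖Y i ω - mean (Y · ω)‖ ^ 2 ∂P := by
        refine mul_le_mul_of_nonneg_left (integral_mono ?_ ?_ fun ω =>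
          quadForm_le_lambda2_mul hm _ (sum_meanSqGossip hA) hlt (sum_sub_mean _)) (by positivity)
        · exact integrable_finsetSum _ fun i _ => integrable_finsetSum _ fun j _ =>
            (integrable_inner_of_memLp (hZ i) (hZ j)).const_mul _
        · exact (integrable_finsetSum _ fun i _ =>
            (hZ i).integrable_norm_pow two_ne_zero).const_mul _
    _ = _ := by
        simp only [spread, avgSq, mean, Fintype.card_fin, smul_eq_mul, integral_const_mul]
        ring

end RandomGossip

section MeasurableLocalSteps

variable {Ω Z E : Type*} [MeasurableSpace Ω] [MeasurableSpace Z] [NormedAddCommGroup E]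
  [NormedSpace ℝ E] [MeasurableSpace E] [BorelSpace E] [SecondCountableTopology E] {g : Z → E → E}
  (hg : Measurable fun p : E × Z => g p.2 p.1) {ξ : Ω → Z} (hξ : Measurable ξ) {X : Ω → E}
  (hX : Measurable X)
include hg hξ hX

theorem measurable_localSteps (η : ℝ) (n : ℕ) :
    Measurable fun ω => localSteps (g (ξ ω)) η (X ω) n := by
  induction n with
  | zero => exact hX
  | succ n ih => exact ih.sub ((hg.comp (ih.prodMk hξ)).const_smul η)

theorem measurable_pathGrad (η : ℝ) (n : ℕ) : Measurable fun ω => pathGrad (g (ξ ω)) η (X ω) n :=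
  Finset.measurable_sum _ fun k _ => hg.comp ((measurable_localSteps hg hξ hX η k).prodMk hξ)

end MeasurableLocalSteps

section History

variable {m : ℕ} {Ξ : Fin m → Type*} [∀ i, MeasurableSpace (Ξ i)] {Ω : Type*}
  {ξ : (i : Fin m) → ℕ → Ω → Ξ i} {A : ℕ → Ω → Finset (Fin m)}

theorem sampleSigma_sup_linkSigma_le_history {r t : ℕ} (h : r < t) :
    sampleSigma ξ r ⊔ linkSigma A r ≤ history ξ A t :=
  le_iSup (fun r : Fin t => sampleSigma ξ r ⊔ linkSigma A r) ⟨r, h⟩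

theorem history_le_succ (t : ℕ) : history ξ A t ≤ history ξ A (t + 1) :=
  iSup_le fun r => sampleSigma_sup_linkSigma_le_history (r.2.trans t.lt_succ_self)

theorem measurable_sample (t : ℕ) (i : Fin m) : Measurable[sampleSigma ξ t] (ξ i t) :=
  (comap_measurable (ξ i t)).mono (le_iSup (fun i => MeasurableSpace.comap (ξ i t) _) i) le_rfl

theorem sampleSigma_le [MeasurableSpace Ω] (hξ : ∀ i t, Measurable (ξ i t)) (t : ℕ) :
    sampleSigma ξ t ≤ ‹MeasurableSpace Ω› :=
  iSup_le fun i => (hξ i t).comap_le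

theorem history_le [MeasurableSpace Ω] (hξ : ∀ i t, Measurable (ξ i t))
    (hA : ∀ t, Measurable[_, ⊤] (A t)) (t : ℕ) : history ξ A t ≤ ‹MeasurableSpace Ω› :=
  iSup_le fun r => sup_le (sampleSigma_le hξ r) (hA r).comap_le

end History

section Dynamics

variable {m d : ℕ} {Ξ : Fin m → Type*} (ℓ : (i : Fin m) → EuclideanSpace ℝ (Fin d) → Ξ i → ℝ)
  {Ω : Type*} (ξ : (i : Fin m) → ℕ → Ω → Ξ i) (A : ℕ → Ω → Finset (Fin m)) (η : ℝ) (s : ℕ)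
  (x₀ : EuclideanSpace ℝ (Fin d))

/-- The stochastic gradient of client `i` at the start of round `t`. -/
noncomputable def startGrad (t : ℕ) (i : Fin m) (ω : Ω) : EuclideanSpace ℝ (Fin d) :=
  stochGrad (ℓ i) (ξ i t ω) (clientModel ℓ ξ A η s x₀ t i ω)

/-- The sum of the stochastic gradients that client `i` uses in round `t`. -/
noncomputable def roundGrad (t : ℕ) (i : Fin m) (ω : Ω) : EuclideanSpace ℝ (Fin d) :=
  pathGrad (stochGrad (ℓ i) (ξ i t ω)) η (clientModel ℓ ξ A η s x₀ t i ω) s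

/-- The model `x_i^{t⋆}` of client `i` after the local steps of round `t`. -/
noncomputable def localModel (t : ℕ) (i : Fin m) (ω : Ω) : EuclideanSpace ℝ (Fin d) :=
  clientModel ℓ ξ A η s x₀ t i ω - η • roundGrad ℓ ξ A η s x₀ t i ω

variable {ℓ ξ A η s x₀}

theorem clientModel_succ (t : ℕ) (i : Fin m) (ω : Ω) :
    clientModel ℓ ξ A η s x₀ (t + 1) i ω = gossip (A t ω) (localModel ℓ ξ A η s x₀ t · ω) i := by
  simp only [localModel, roundGrad, ← localSteps_eq_sub_pathGrad]
  exact congrFun (round_snd _ _ _ _ _) i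

theorem avgModel_eq_mean (t : ℕ) (ω : Ω) :
    avgModel ℓ ξ A η s x₀ t ω = mean (clientModel ℓ ξ A η s x₀ t · ω) := by
  rw [avgModel, mean, Fintype.card_fin, one_div]

theorem avgModel_succ (t : ℕ) (ω : Ω) :
    avgModel ℓ ξ A η s x₀ (t + 1) ω
      = mean (clientModel ℓ ξ A η s x₀ t · ω) - η • mean (roundGrad ℓ ξ A η s x₀ t · ω) := by
  simp only [avgModel_eq_mean, clientModel_succ]
  rw [← mean_smul, ← mean_sub]
  exact mean_gossip _ _

variable [∀ i, MeasurableSpace (Ξ i)] {L : Fin m → ℝ≥0} (hℓ : ∀ i, SmoothLoss (L i) (ℓ i))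
include hℓ

theorem norm_roundGrad_sub_le (hη : 0 < η) (t : ℕ) (i : Fin m) (ω : Ω) :
    ‖roundGrad ℓ ξ A η s x₀ t i ω - (s : ℝ) • startGrad ℓ ξ A η s x₀ t i ω‖
      ≤ drift L η s * ‖startGrad ℓ ξ A η s x₀ t i ω‖ :=
  (norm_pathGrad_sub_le ((hℓ i).lipschitz _) hη.le _ s).trans
    (mul_le_mul_of_nonneg_right (sum_one_add_pow_sub_one_le_drift L hη s i) (norm_nonneg _))

section Measurability

variable {t : ℕ} (hX : ∀ i, Measurable[history ξ A t] (clientModel ℓ ξ A η s x₀ t i)) (i : Fin m)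
include hX

theorem measurable_startGrad :
    Measurable[history ξ A t ⊔ sampleSigma ξ t] (startGrad ℓ ξ A η s x₀ t i) :=
  (hℓ i).measurable_stochGrad.comp
    (((hX i).mono le_sup_left le_rfl).prodMk ((measurable_sample t i).mono le_sup_right le_rfl))

theorem measurable_roundGrad :
    Measurable[history ξ A t ⊔ sampleSigma ξ t] (roundGrad ℓ ξ A η s x₀ t i) :=
  @measurable_pathGrad _ _ _ (history ξ A t ⊔ sampleSigma ξ t) _ _ _ _ _ _ _
    (hℓ i).measurable_stochGrad _ ((measurable_sample t i).mono le_sup_right le_rfl) _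
    ((hX i).mono le_sup_left le_rfl) η s

theorem measurable_localModel :
    Measurable[history ξ A t ⊔ sampleSigma ξ t] (localModel ℓ ξ A η s x₀ t i) :=
  ((hX i).mono le_sup_left le_rfl).sub ((measurable_roundGrad hℓ hX i).const_smul η)

end Measurability

theorem measurable_clientModel (t : ℕ) (i : Fin m) :
    Measurable[history ξ A t] (clientModel ℓ ξ A η s x₀ t i) := by
  induction t generalizing i with
  | zero => exact measurable_const
  | succ t ih =>
    have hnext := sampleSigma_sup_linkSigma_le_history (ξ := ξ) (A := A) t.lt_succ_self
    rw [funext (clientModel_succ (ℓ := ℓ) (ξ := ξ) (A := A) t i)]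
    refine Finset.measurable_sum _ fun j _ => Measurable.fun_smul ?_ ?_
    · exact (measurable_comp_link (gossipMatrix · i j) t).mono (le_sup_right.trans hnext) le_rfl
    · exact (measurable_localModel hℓ ih j).mono
        (sup_le (history_le_succ t) (le_sup_left.trans hnext)) le_rfl

variable [MeasurableSpace Ω] {P : Measure Ω} [IsProbabilityMeasure P]
  (hξ : ∀ i t, Measurable (ξ i t)) (hA : ∀ t, Measurable[_, ⊤] (A t))
include hξ hA

variable {H : Fin m → EuclideanSpace ℝ (Fin d) → EuclideanSpace ℝ (Fin d)} {K : ℝ≥0}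
  (hH : ∀ i, LipschitzWith K (H i)) {σ : ℝ} {T : ℕ} (hvar : ∀ t < T, ∀ i,
    CondVarianceLE P (history ξ A t) (fun x ω => stochGrad (ℓ i) (ξ i t ω) x) (H i) σ)
include hH hvar

section Noise

variable {t : ℕ} (ht : t < T) (i : Fin m)
include ht

theorem memLp_startGrad_sub_and_integral_le :
    MemLp (fun ω => startGrad ℓ ξ A η s x₀ t i ω - H i (clientModel ℓ ξ A η s x₀ t i ω)) 2 P ∧
    ∫ ω, ‖startGrad ℓ ξ A η s x₀ t i ω - H i (clientModel ℓ ξ A η s x₀ t i ω)‖ ^ 2 ∂P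
      ≤ σ ^ 2 := by
  have hX := measurable_clientModel hℓ (ξ := ξ) (A := A) (η := η) (s := s) (x₀ := x₀) t
  have hstart := ((measurable_startGrad hℓ hX i).mono
    (sup_le (history_le hξ hA t) (sampleSigma_le hξ t)) le_rfl).aestronglyMeasurable (μ := P)
  have hcont ω : Continuous fun x => stochGrad (ℓ i) (ξ i t ω) x := ((hℓ i).lipschitz _).continuous
  have hmeas x : StronglyMeasurable fun ω => stochGrad (ℓ i) (ξ i t ω) x :=
    ((hℓ i).measurable_stochGrad.comp (measurable_const.prodMk (hξ i t))).stronglyMeasurable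
  exact ⟨(hvar t ht i).memLp_comp_sub (history_le hξ hA t) hcont (hH i).continuous hmeas
      (hX i).stronglyMeasurable hstart,
    (hvar t ht i).integral_norm_sq_comp_sub_le (history_le hξ hA t) hcont (hH i).continuous hmeas
      (hX i).stronglyMeasurable hstart⟩

theorem memLp_startGrad (hX : MemLp (clientModel ℓ ξ A η s x₀ t i) 2 P) :
    MemLp (startGrad ℓ ξ A η s x₀ t i) 2 P :=
  ((memLp_startGrad_sub_and_integral_le hℓ hξ hA hH hvar ht i).1.add
    (memLp_comp_lipschitz (hH i) hX)).ae_eq (ae_of_all _ fun _ => sub_add_cancel _ _)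

theorem memLp_roundGrad (hη : 0 < η) (hX : MemLp (clientModel ℓ ξ A η s x₀ t i) 2 P) :
    MemLp (roundGrad ℓ ξ A η s x₀ t i) 2 P :=
  (memLp_startGrad hℓ hξ hA hH hvar ht i hX).of_le_mul
    ((measurable_roundGrad hℓ (measurable_clientModel hℓ t) i).mono
      (sup_le (history_le hξ hA t) (sampleSigma_le hξ t)) le_rfl).aestronglyMeasurable
    (ae_of_all _ fun ω =>
      norm_le_of_norm_sub_smul_le s.cast_nonneg (norm_roundGrad_sub_le hℓ hη t i ω))

theorem memLp_localModel (hη : 0 < η) (hX : MemLp (clientModel ℓ ξ A η s x₀ t i) 2 P) :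
    MemLp (localModel ℓ ξ A η s x₀ t i) 2 P :=
  hX.sub ((memLp_roundGrad hℓ hξ hA hH hvar ht i hη hX).const_smul η)

end Noise

variable (hη : 0 < η)
include hη

theorem memLp_clientModel {t : ℕ} (ht : t ≤ T) (i : Fin m) :
    MemLp (clientModel ℓ ξ A η s x₀ t i) 2 P := by
  induction t generalizing i with
  | zero => exact memLp_const x₀
  | succ t ih =>
    rw [funext (clientModel_succ (ℓ := ℓ) (ξ := ξ) (A := A) t i)]
    exact memLp_gossip (hA t)
      (fun j => memLp_localModel hℓ hξ hA hH hvar ht j hη (ih (by omega) j)) i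

theorem unbiasedGradients {t : ℕ} (ht : t < T)
    (hunb : ∀ i, P[startGrad ℓ ξ A η s x₀ t i | history ξ A t]
      =ᵐ[P] fun ω => H i (clientModel ℓ ξ A η s x₀ t i ω)) :
    UnbiasedGradients P (history ξ A t) H (clientModel ℓ ξ A η s x₀ t)
      (startGrad ℓ ξ A η s x₀ t) where
  stronglyMeasurable i := (measurable_clientModel hℓ t i).stronglyMeasurable
  memLp_point := memLp_clientModel hℓ hξ hA hH hvar hη ht.le
  memLp_grad i := memLp_startGrad hℓ hξ hA hH hvar ht i
    (memLp_clientModel hℓ hξ hA hH hvar hη ht.le i)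
  condExp_grad := hunb

end Dynamics

section Recursion

theorem sum_le_of_contracting {v b : ℕ → ℝ} {r : ℝ} (hr : r < 1) (hv₀ : v 0 = 0) {T : ℕ}
    (hvT : 0 ≤ v T) (h : ∀ t < T, v (t + 1) ≤ r * v t + b t) :
    ∑ t ∈ Finset.range T, v t ≤ (∑ t ∈ Finset.range T, b t) / (1 - r) := by
  have hsum := Finset.sum_le_sum fun t ht => h t (Finset.mem_range.1 ht)
  rw [Finset.sum_add_distrib, ← Finset.mul_sum] at hsum
  have shift := (Finset.sum_range_succ' v T).symm.trans (Finset.sum_range_succ v T)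
  rw [le_div_iff₀ (sub_pos.2 hr)]
  linarith

/-- Everything is expressed in units in which the step size condition bounds `p * B` and
`w * B * (1 + e)`: the squared gradients `U` then exceed `2 * M + 2 * B * A` by a small fraction
only, and the terms `U` contributes to the descent inequality are absorbed into its left side. -/
theorem le_of_descent_of_consensus {A Δ M U V B e p w : ℝ} (hA : 0 ≤ A) (hM : 0 ≤ M)
    (hU₀ : 0 ≤ U) (hB : 1 ≤ B) (he : 0 ≤ e) (hw : 0 ≤ w) (hwp : w ≤ p) (hpB : p * B ≤ 1 / 108)
    (hwB : w * B * (1 + e) ≤ 1 / 108) (hU : U ≤ 2 * M + 2 * V + 2 * B * A)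
    (hV : V ≤ 2 * p ^ 2 * U) (hdescent : 3 / 8 * A ≤ Δ + V / 2 + (e * w + 2 * w) * U) :
    A ≤ 6 * Δ + 54 * (e * w + w + p) * M := by
  have hp₀ : 0 ≤ p := hw.trans hwp
  have hp : p ≤ 1 / 108 := (le_mul_of_one_le_right hp₀ hB).trans hpB
  have hew : 0 ≤ e * w := mul_nonneg he hw
  set q := p ^ 2 + (e * w + 2 * w)
  have hq_le : q ≤ 2 * (e * w + w + p) := by
    linarith [pow_le_of_le_one hp₀ (by linarith) two_ne_zero]
  have hqB : q * B ≤ 1 / 40 := by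
    linarith [mul_le_mul hp hpB (by positivity) (by norm_num), mul_nonneg hew (by linarith : 0 ≤ B)]
  have hV_le : V ≤ U / 5000 := by
    linarith [mul_le_mul_of_nonneg_right (pow_le_pow_left₀ hp₀ hp 2) hU₀]
  have hU_le : U ≤ 21 / 10 * (M + B * A) := by linarith
  have hdescent_le : 3 / 8 * A ≤ Δ + 21 / 10 * (q * M) + 21 / 10 * (q * B * A) := by
    linarith [mul_le_mul_of_nonneg_left hU_le (by positivity : 0 ≤ q)]
  linarith [mul_le_mul_of_nonneg_right hqB hA, mul_le_mul_of_nonneg_right hq_le hM,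
    mul_nonneg (add_nonneg (add_nonneg hew hw) hp₀) hM]

theorem mul_le_of_le_div {η s K B e c : ℝ} (hη : 0 < η) (hs : 1 ≤ s) (hK : 1 ≤ K) (hB : 1 ≤ B)
    (he : 0 ≤ e) (h : η ≤ c / (108 * K ^ 2 * s ^ 3 * B * (1 + e))) :
    η * s * K * B * (1 + e) ≤ c / 108 := by
  rw [le_div_iff₀ (by positivity)] at h
  calc η * s * K * B * (1 + e) ≤ η * s ^ 3 * K ^ 2 * B * (1 + e) := by
        gcongr
        · exact le_self_pow₀ hs three_ne_zero
        · exact le_self_pow₀ hK two_ne_zero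
    _ ≤ c / 108 := by linarith

theorem drift_bounds {κ K s w δ : ℝ} (hK : 1 ≤ K) (hs : 0 ≤ s) (hw : 0 ≤ w)
    (hwe : w * (1 + κ ^ 2 * K ^ 2) ≤ 1 / 108) (hδ₀ : 0 ≤ δ) (hδ : δ ≤ κ * w / 2 * s) :
    (s + δ) ^ 2 ≤ 2 * s ^ 2 ∧ 2 * δ ^ 2 ≤ κ ^ 2 * K ^ 2 * w * s ^ 2 := by
  have hκ_le : κ ^ 2 ≤ κ ^ 2 * K ^ 2 := le_mul_of_one_le_right (sq_nonneg κ) (one_le_pow₀ hK)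
  have hw_le : w ≤ 1 := by linarith [mul_nonneg hw (by positivity : 0 ≤ κ ^ 2 * K ^ 2)]
  have hκw : κ * w ≤ 1 / 2 := by
    linarith [mul_nonneg hw (sq_nonneg (κ - 1)), mul_le_mul_of_nonneg_left hκ_le hw]
  have hδs : δ ≤ s / 4 := by linarith [mul_le_mul_of_nonneg_right hκw hs]
  constructor
  · calc (s + δ) ^ 2 ≤ (s + s / 4) ^ 2 := by gcongr
      _ ≤ 2 * s ^ 2 := by linarith [sq_nonneg s]
  · calc 2 * δ ^ 2 ≤ 2 * (κ * w / 2 * s) ^ 2 := by gcongr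
      _ = κ ^ 2 * (w * w / 2) * s ^ 2 := by ring
      _ ≤ κ ^ 2 * K ^ 2 * w * s ^ 2 := by
        gcongr
        linarith [mul_le_of_le_one_left hw hw_le]

theorem le_of_summed_estimates {A D M U V K κ η s r β δ : ℝ} (hK : 1 ≤ K) (hη : 0 < η)
    (hs : 1 ≤ s) (hr₀ : 0 ≤ r) (hr₁ : r < 1) (hA : 0 ≤ A) (hM : 0 ≤ M) (hU₀ : 0 ≤ U)
    (hδ₀ : 0 ≤ δ) (hδ : δ ≤ κ * (s ^ 2 / 2) * η * K)
    (hη_le : η ≤ (1 - r) / (108 * K ^ 2 * s ^ 3 * (β ^ 2 + 1) * (1 + κ ^ 2 * K ^ 2)))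
    (hU : U ≤ 2 * M + 2 * K ^ 2 * V + 2 * (β ^ 2 + 1) * A)
    (hV : V ≤ (1 / (1 - r) * (η ^ 2 * (s + δ) ^ 2) * U) / (1 - r))
    (hdescent : 3 / 8 * (η * s) * A ≤ D + η * s / 2 * K ^ 2 * V
      + (2 * η / s * δ ^ 2 + K * η ^ 2 * (s + δ) ^ 2) * U) :
    A ≤ 6 * (D / (η * s))
      + 54 * (κ ^ 2 * K ^ 2 * (η * s * K) + η * s * K + η * s * K / (1 - r)) * M := by
  have hr : 0 < 1 - r := sub_pos.2 hr₁
  have hB : 1 ≤ β ^ 2 + 1 := by linarith [sq_nonneg β]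
  have he : 0 ≤ κ ^ 2 * K ^ 2 := by positivity
  have hw : 0 ≤ η * s * K := by positivity
  have hstep := mul_le_of_le_div hη hs hK hB he hη_le
  have hwB : η * s * K * (β ^ 2 + 1) * (1 + κ ^ 2 * K ^ 2) ≤ 1 / 108 := hstep.trans (by linarith)
  have hpB : η * s * K / (1 - r) * (β ^ 2 + 1) ≤ 1 / 108 := by
    rw [div_mul_eq_mul_div, div_le_iff₀ hr]
    linarith [mul_nonneg (mul_nonneg hw (by linarith : 0 ≤ β ^ 2 + 1)) he]
  obtain ⟨hsδ, hδ_sq⟩ := drift_bounds (s := s) hK (by linarith) hw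
    ((mul_le_mul_of_nonneg_right (le_mul_of_one_le_right hw hB) (by positivity)).trans hwB)
    hδ₀ (hδ.trans_eq (by ring))
  refine le_of_descent_of_consensus hA hM hU₀ hB he hw (le_div_self hw hr (by linarith)) hpB hwB
    (V := K ^ 2 * V) (hU.trans_eq (by ring)) ?_ ?_
  · calc K ^ 2 * V ≤ K ^ 2 * ((1 / (1 - r) * (η ^ 2 * (2 * s ^ 2)) * U) / (1 - r)) := by
          gcongr
          exact hV.trans (by gcongr)
      _ = 2 * (η * s * K / (1 - r)) ^ 2 * U := by field_simp
  · refine le_of_mul_le_mul_left ?_ (by positivity : 0 < η * s)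
    calc η * s * (3 / 8 * A)
        = 3 / 8 * (η * s) * A := by ring
      _ ≤ D + η * s / 2 * K ^ 2 * V
          + (2 * η / s * δ ^ 2 + K * η ^ 2 * (s + δ) ^ 2) * U := hdescent
      _ = D + η * s / 2 * K ^ 2 * V
          + (η / s * (2 * δ ^ 2) + K * η ^ 2 * (s + δ) ^ 2) * U := by ring
      _ ≤ D + η * s / 2 * K ^ 2 * V
          + (η / s * (κ ^ 2 * K ^ 2 * (η * s * K) * s ^ 2) + K * η ^ 2 * (2 * s ^ 2)) * U := by
        gcongr
      _ = _ := by
        field_simp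

section Rounds

variable {f a v u : ℕ → ℝ} {T : ℕ}

theorem sum_le_of_forall_le_affine {w x y z : ℝ}
    (h : ∀ t < T, u t ≤ w + (x * v t + y * a t + z)) :
    ∑ t ∈ Finset.range T, u t
      ≤ T * (w + z) + x * ∑ t ∈ Finset.range T, v t + y * ∑ t ∈ Finset.range T, a t := by
  have hsum := Finset.sum_le_sum fun t ht => h t (Finset.mem_range.1 ht)
  simp only [Finset.sum_add_distrib, ← Finset.mul_sum, Finset.sum_const, Finset.card_range,
    nsmul_eq_mul] at hsum
  linarith

theorem mul_sum_le_of_descent {x y z Fstar : ℝ} (hfT : Fstar ≤ f T)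
    (h : ∀ t < T, f (t + 1) ≤ f t - x * a t + y * v t + z * u t) :
    x * ∑ t ∈ Finset.range T, a t
      ≤ f 0 - Fstar + y * ∑ t ∈ Finset.range T, v t + z * ∑ t ∈ Finset.range T, u t := by
  have hsum := Finset.sum_le_sum fun t ht => h t (Finset.mem_range.1 ht)
  simp only [Finset.sum_add_distrib, Finset.sum_sub_distrib, ← Finset.mul_sum] at hsum
  have telescope := Finset.sum_range_sub f T
  rw [Finset.sum_sub_distrib] at telescope
  linarith

theorem average_le_of_recursion {Fstar K κ η s r σ β ζ δ : ℝ} (hT : 1 ≤ T) (hK : 1 ≤ K)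
    (hη : 0 < η) (hs : 1 ≤ s) (hr₀ : 0 ≤ r) (hr₁ : r < 1)
    (ha : ∀ t, 0 ≤ a t) (hu : ∀ t, 0 ≤ u t) (hv₀ : v 0 = 0) (hvT : 0 ≤ v T) (hfT : Fstar ≤ f T)
    (hδ₀ : 0 ≤ δ) (hδ : δ ≤ κ * (s ^ 2 / 2) * η * K)
    (hη_le : η ≤ (1 - r) / (108 * K ^ 2 * s ^ 3 * (β ^ 2 + 1) * (1 + κ ^ 2 * K ^ 2)))
    (gradient_le : ∀ t < T,
      u t ≤ σ ^ 2 + (2 * K ^ 2 * v t + 2 * (β ^ 2 + 1) * a t + 2 * ζ ^ 2))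
    (descent : ∀ t < T, f (t + 1) ≤ f t - 3 / 8 * (η * s) * a t + η * s / 2 * K ^ 2 * v t
      + (2 * η / s * δ ^ 2 + K * η ^ 2 * (s + δ) ^ 2) * u t)
    (consensus : ∀ t < T, v (t + 1) ≤ r * v t + 1 / (1 - r) * (η ^ 2 * (s + δ) ^ 2) * u t) :
    1 / T * ∑ t ∈ Finset.range T, a t
      ≤ 6 * (f 0 - Fstar) / (η * s * T)
        + 54 * η * s * K * (κ ^ 2 * K ^ 2 + 1 + 1 / (1 - r)) * (σ ^ 2 + ζ ^ 2) := by
  have hT₀ : (0 : ℝ) < T := by exact_mod_cast hT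
  have sum_v := sum_le_of_contracting hr₁ hv₀ hvT consensus
  rw [← Finset.mul_sum] at sum_v
  have sum_a := le_of_summed_estimates (M := T * (σ ^ 2 + ζ ^ 2)) hK hη hs hr₀ hr₁
    (Finset.sum_nonneg fun t _ => ha t) (by positivity) (Finset.sum_nonneg fun t _ => hu t) hδ₀ hδ
    hη_le ((sum_le_of_forall_le_affine gradient_le).trans ?_) sum_v
    (mul_sum_le_of_descent hfT descent)
  · rw [one_div_mul_eq_div, div_le_iff₀ hT₀]
    refine sum_a.trans_eq ?_
    have : 1 - r ≠ 0 := (sub_pos.2 hr₁).ne'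
    field_simp
  · linarith [mul_nonneg hT₀.le (sq_nonneg σ)]

end Rounds

end Recursion

section RoundEstimates

variable {m d : ℕ} {Ξ : Fin m → Type*} [∀ i, MeasurableSpace (Ξ i)]
  {ℓ : (i : Fin m) → EuclideanSpace ℝ (Fin d) → Ξ i → ℝ} {Ω : Type*} [MeasurableSpace Ω]
  {P : Measure Ω} {ξ : (i : Fin m) → ℕ → Ω → Ξ i} {A : ℕ → Ω → Finset (Fin m)}

theorem lambda2_le_sqrt_rho_sq (hm : 2 ≤ m) {T t : ℕ} (ht : t < T) :
    lambda2 hm (meanSqGossip_isHermitian P A t) ≤ √(rho hm P A T) ^ 2 := by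
  have hle : lambda2 hm (meanSqGossip_isHermitian P A t) ≤ rho hm P A T :=
    le_ciSup (f := fun t : Fin T => lambda2 hm (meanSqGossip_isHermitian P A t))
      (Set.finite_range _).bddAbove ⟨t, ht⟩
  rcases le_total 0 (rho hm P A T) with h | h
  · rwa [Real.sq_sqrt h]
  · exact (hle.trans h).trans (sq_nonneg _)

variable [IsProbabilityMeasure P] {L : Fin m → ℝ≥0} {η : ℝ} {s : ℕ}
  {x₀ : EuclideanSpace ℝ (Fin d)} (hℓ : ∀ i, SmoothLoss (L i) (ℓ i))
  (hξ : ∀ i t, Measurable (ξ i t)) (hA : ∀ t, Measurable[_, ⊤] (A t))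
  {H : Fin m → EuclideanSpace ℝ (Fin d) → EuclideanSpace ℝ (Fin d)} {K : ℝ≥0}
  (hH : ∀ i, LipschitzWith K (H i)) {σ : ℝ} {T : ℕ} (hvar : ∀ t < T, ∀ i,
    CondVarianceLE P (history ξ A t) (fun x ω => stochGrad (ℓ i) (ξ i t ω) x) (H i) σ)
  (hη : 0 < η) {t : ℕ} (ht : t < T)
include hℓ hξ hA hH hvar hη ht

theorem integral_spread_clientModel_succ_le (hm : 2 ≤ m)
    (hind : Indep (linkSigma A t) (history ξ A t ⊔ sampleSigma ξ t) P) {r : ℝ} (hr₀ : 0 ≤ r)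
    (hr₁ : r < 1) (hr : lambda2 hm (meanSqGossip_isHermitian P A t) ≤ r ^ 2) :
    ∫ ω, spread (clientModel ℓ ξ A η s x₀ (t + 1) · ω) ∂P
      ≤ r * ∫ ω, spread (clientModel ℓ ξ A η s x₀ t · ω) ∂P
        + 1 / (1 - r) * (η ^ 2 * (s + drift L η s) ^ 2)
          * ∫ ω, avgSq (startGrad ℓ ξ A η s x₀ t · ω) ∂P := by
  have : Nonempty (Fin m) := ⟨⟨0, by omega⟩⟩
  have hX := memLp_clientModel hℓ hξ hA hH hvar hη (x₀ := x₀) (s := s) ht.le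
  simp only [clientModel_succ]
  calc ∫ ω, spread (gossip (A t ω) (localModel ℓ ξ A η s x₀ t · ω)) ∂P
      ≤ lambda2 hm (meanSqGossip_isHermitian P A t)
          * ∫ ω, spread (localModel ℓ ξ A η s x₀ t · ω) ∂P :=
        integral_spread_gossip_le (hA t) hm (hr.trans_lt (pow_lt_one₀ hr₀ hr₁ two_ne_zero))
          (sup_le (history_le hξ hA t) (sampleSigma_le hξ t)) hind
          (fun i => (measurable_localModel hℓ (measurable_clientModel hℓ t) i).stronglyMeasurable)
          (fun i => memLp_localModel hℓ hξ hA hH hvar ht i hη (hX i))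
    _ ≤ r ^ 2 * ∫ ω, spread (localModel ℓ ξ A η s x₀ t · ω) ∂P :=
        mul_le_mul_of_nonneg_right hr (integral_nonneg fun _ => spread_nonneg _)
    _ ≤ _ := integral_spread_sub_smul_le hX
        (fun i => memLp_startGrad hℓ hξ hA hH hvar ht i (hX i))
        (fun i => memLp_roundGrad hℓ hξ hA hH hvar ht i hη (hX i)) hr₀ hr₁ s.cast_nonneg
        (norm_roundGrad_sub_le hℓ hη t)

variable (hunb : ∀ i, P[startGrad ℓ ξ A η s x₀ t i | history ξ A t]
  =ᵐ[P] fun ω => H i (clientModel ℓ ξ A η s x₀ t i ω)) [Nonempty (Fin m)]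
include hunb

theorem integral_avgSq_startGrad_le {β ζ : ℝ}
    (hdis : ∀ x, spread (H · x) ≤ β ^ 2 * ‖mean (H · x)‖ ^ 2 + ζ ^ 2) :
    ∫ ω, avgSq (startGrad ℓ ξ A η s x₀ t · ω) ∂P
      ≤ σ ^ 2 + (2 * K ^ 2 * ∫ ω, spread (clientModel ℓ ξ A η s x₀ t · ω) ∂P
        + 2 * (β ^ 2 + 1) * ∫ ω, ‖mean (H · (avgModel ℓ ξ A η s x₀ t ω))‖ ^ 2 ∂P
        + 2 * ζ ^ 2) := by
  simp only [avgModel_eq_mean]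
  exact (unbiasedGradients hℓ hξ hA hH hvar hη ht hunb).integral_avgSq_le (history_le hξ hA t) hH
    (fun i => (memLp_startGrad_sub_and_integral_le hℓ hξ hA hH hvar ht i).2) hdis

theorem integral_comp_avgModel_succ_le (hs : 0 < s) {F : EuclideanSpace ℝ (Fin d) → ℝ}
    (hF : ∀ x, HasGradientAt F (mean (H · x)) x) :
    ∫ ω, F (avgModel ℓ ξ A η s x₀ (t + 1) ω) ∂P
      ≤ ∫ ω, F (avgModel ℓ ξ A η s x₀ t ω) ∂P
        - 3 / 8 * (η * s) * ∫ ω, ‖mean (H · (avgModel ℓ ξ A η s x₀ t ω))‖ ^ 2 ∂P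
        + η * s / 2 * K ^ 2 * ∫ ω, spread (clientModel ℓ ξ A η s x₀ t · ω) ∂P
        + (2 * η / s * drift L η s ^ 2 + K * η ^ 2 * (s + drift L η s) ^ 2)
          * ∫ ω, avgSq (startGrad ℓ ξ A η s x₀ t · ω) ∂P := by
  simp only [avgModel_succ, avgModel_eq_mean]
  exact (unbiasedGradients hℓ hξ hA hH hvar hη ht hunb).integral_comp_sub_smul_mean_le
    (history_le hξ hA t) hH hF
    (fun i => memLp_roundGrad hℓ hξ hA hH hvar ht i hη
      (memLp_clientModel hℓ hξ hA hH hvar hη ht.le i)) hη.le (Nat.cast_pos.2 hs)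
    (norm_roundGrad_sub_le hℓ hη t)

end RoundEstimates

section AverageModel

variable {m d : ℕ} {Ξ : Fin m → Type*}
  {ℓ : (i : Fin m) → EuclideanSpace ℝ (Fin d) → Ξ i → ℝ} {Ω : Type*} [MeasurableSpace Ω]
  {P : Measure Ω} {ξ : (i : Fin m) → ℕ → Ω → Ξ i} {A : ℕ → Ω → Finset (Fin m)} {η : ℝ} {s : ℕ}
  {x₀ : EuclideanSpace ℝ (Fin d)}

theorem integral_spread_clientModel_zero [Nonempty (Fin m)] :
    ∫ ω, spread (clientModel ℓ ξ A η s x₀ 0 · ω) ∂P = 0 :=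
  integral_eq_zero_of_ae (ae_of_all _ fun _ => spread_const x₀)

variable [IsProbabilityMeasure P]

theorem integral_comp_avgModel_zero [Nonempty (Fin m)] (F : EuclideanSpace ℝ (Fin d) → ℝ) :
    ∫ ω, F (avgModel ℓ ξ A η s x₀ 0 ω) ∂P = F x₀ := by
  have h ω : avgModel ℓ ξ A η s x₀ 0 ω = x₀ := (avgModel_eq_mean 0 ω).trans (mean_const x₀)
  simp only [h, integral_const, probReal_univ, one_smul]

variable [∀ i, MeasurableSpace (Ξ i)] {L : Fin m → ℝ≥0} (hℓ : ∀ i, SmoothLoss (L i) (ℓ i))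
  (hξ : ∀ i t, Measurable (ξ i t)) (hA : ∀ t, Measurable[_, ⊤] (A t))
  {H : Fin m → EuclideanSpace ℝ (Fin d) → EuclideanSpace ℝ (Fin d)} {K : ℝ≥0}
  (hH : ∀ i, LipschitzWith K (H i)) {σ : ℝ} {T : ℕ} (hvar : ∀ t < T, ∀ i,
    CondVarianceLE P (history ξ A t) (fun x ω => stochGrad (ℓ i) (ξ i t ω) x) (H i) σ)
  (hη : 0 < η)
include hℓ hξ hA hH hvar hη

section Round

variable {t : ℕ} (ht : t ≤ T)
include ht

theorem memLp_avgModel : MemLp (avgModel ℓ ξ A η s x₀ t) 2 P := by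
  rw [funext (avgModel_eq_mean t)]
  exact memLp_mean fun i => memLp_clientModel hℓ hξ hA hH hvar hη ht i

theorem integrable_norm_sq_mean_avgModel [Nonempty (Fin m)] :
    Integrable (fun ω => ‖mean (H · (avgModel ℓ ξ A η s x₀ t ω))‖ ^ 2) P :=
  (memLp_comp_lipschitz (lipschitzWith_mean hH)
    (memLp_avgModel hℓ hξ hA hH hvar hη ht)).integrable_norm_pow two_ne_zero

theorem le_integral_comp_avgModel [Nonempty (Fin m)] {F : EuclideanSpace ℝ (Fin d) → ℝ}
    (hF : ∀ x, HasGradientAt F (mean (H · x)) x) {Fstar : ℝ} (hFstar : ∀ x, Fstar ≤ F x) :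
    Fstar ≤ ∫ ω, F (avgModel ℓ ξ A η s x₀ t ω) ∂P := by
  have hint := integrable_comp_of_hasGradientAt hF (lipschitzWith_mean hH)
    (memLp_avgModel hℓ hξ hA hH hvar hη (x₀ := x₀) (s := s) ht)
  simpa only [integral_const, probReal_univ, one_smul] using
    integral_mono (integrable_const Fstar) hint fun ω => hFstar _

end Round

theorem average_integral_norm_sq_mean_avgModel_le (hm : 2 ≤ m) (hT : 1 ≤ T) (hs : 1 ≤ s)
    (hK : 1 ≤ K) (hLK : maxLip L ≤ K)
    (hunb : ∀ t < T, ∀ i, P[startGrad ℓ ξ A η s x₀ t i | history ξ A t]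
      =ᵐ[P] fun ω => H i (clientModel ℓ ξ A η s x₀ t i ω))
    (hind : ∀ t < T, Indep (linkSigma A t) (history ξ A t ⊔ sampleSigma ξ t) P) {r : ℝ}
    (hr₀ : 0 ≤ r) (hr₁ : r < 1)
    (hr : ∀ t < T, lambda2 hm (meanSqGossip_isHermitian P A t) ≤ r ^ 2)
    {F : EuclideanSpace ℝ (Fin d) → ℝ} (hF : ∀ x, HasGradientAt F (mean (H · x)) x) {Fstar : ℝ}
    (hFstar : ∀ x, Fstar ≤ F x) {β ζ : ℝ}
    (hdis : ∀ x, spread (H · x) ≤ β ^ 2 * ‖mean (H · x)‖ ^ 2 + ζ ^ 2)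
    (hη_le : η ≤ (1 - r) /
      (108 * K ^ 2 * (s : ℝ) ^ 3 * (β ^ 2 + 1) * (1 + kappa L η s ^ 2 * K ^ 2))) :
    1 / (T : ℝ) * ∑ t ∈ Finset.range T, ∫ ω, ‖mean (H · (avgModel ℓ ξ A η s x₀ t ω))‖ ^ 2 ∂P
      ≤ 6 * (F x₀ - Fstar) / (η * s * T)
        + 54 * η * s * K * (kappa L η s ^ 2 * K ^ 2 + 1 + 1 / (1 - r)) * (σ ^ 2 + ζ ^ 2) := by
  have : Nonempty (Fin m) := ⟨⟨0, by omega⟩⟩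
  have hδ : drift L η s ≤ kappa L η s * (s ^ 2 / 2) * η * K := by
    have := kappa_nonneg L hη.le s
    exact (drift_le L hη.le s).trans (by gcongr)
  rw [← integral_comp_avgModel_zero (P := P) (ℓ := ℓ) (ξ := ξ) (A := A) (η := η) (s := s) F]
  exact average_le_of_recursion (f := fun t => ∫ ω, F (avgModel ℓ ξ A η s x₀ t ω) ∂P)
    hT hK hη (Nat.one_le_cast.2 hs) hr₀ hr₁ (fun _ => integral_nonneg fun _ => sq_nonneg _)
    (fun _ => integral_nonneg fun _ => avgSq_nonneg _) integral_spread_clientModel_zero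
    (integral_nonneg fun _ => spread_nonneg _)
    (le_integral_comp_avgModel hℓ hξ hA hH hvar hη le_rfl hF hFstar)
    (drift_nonneg L hη.le s) hδ hη_le
    (fun t ht => integral_avgSq_startGrad_le hℓ hξ hA hH hvar hη ht (hunb t ht) hdis)
    (fun t ht => integral_comp_avgModel_succ_le hℓ hξ hA hH hvar hη ht (hunb t ht) hs hF)
    (fun t ht => integral_spread_clientModel_succ_le hℓ hξ hA hH hvar hη ht hm (hind t ht) hr₀ hr₁
      (hr t ht))

end AverageModel

end FedPBC

open FedPBC

theorem mainTheorem1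
    {m d : ℕ} (hm : 2 ≤ m)
    -- the data of the clients: sample spaces, distributions and loss functions
    {Ξ : Fin m → Type*} [∀ i, MeasurableSpace (Ξ i)]
    (D : (i : Fin m) → Measure (Ξ i)) [∀ i, IsProbabilityMeasure (D i)]
    (ℓ : (i : Fin m) → EuclideanSpace ℝ (Fin d) → Ξ i → ℝ)
    (hℓ_meas : ∀ i x, Measurable (ℓ i x))
    (hℓ_int : ∀ i x, Integrable (ℓ i x) (D i))
    -- the randomness: samples `ξ i t` and sets `A t` of active uplinks
    {Ω : Type*} [MeasurableSpace Ω] (P : Measure Ω) [IsProbabilityMeasure P]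
    (ξ : (i : Fin m) → ℕ → Ω → Ξ i) (hξ : ∀ i t, Measurable (ξ i t))
    (A : ℕ → Ω → Finset (Fin m)) (hA : ∀ t, Measurable[_, ⊤] (A t))
    -- parameters of the algorithm: rounds, local steps, learning rate, initial model
    (T s : ℕ) (hT : 1 ≤ T) (hs : 1 ≤ s) (η : ℝ) (hη : 0 < η)
    (x₀ : EuclideanSpace ℝ (Fin d))
    -- the uplinks of a round are independent of the past and of the samples of that round
    (hA_indep : ∀ t < T, Indep (FedPBC.linkSigma A t)
      (FedPBC.history ξ A t ⊔ FedPBC.sampleSigma ξ t) P)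
    -- smoothness
    (L : Fin m → ℝ≥0)
    (hℓ_diff : ∀ i z, Differentiable ℝ (fun x => ℓ i x z))
    (hℓ_lip : ∀ i z, LipschitzWith (L i) (FedPBC.stochGrad (ℓ i) z))
    (hL : 1 ≤ FedPBC.maxLip L)
    -- unbiased stochastic gradients at the start of each round, with bounded variance
    (σ : ℝ)
    (h_unbiased : ∀ t < T, ∀ i,
      P[fun ω => FedPBC.stochGrad (ℓ i) (ξ i t ω) (FedPBC.clientModel ℓ ξ A η s x₀ t i ω)
          | FedPBC.history ξ A t]
        =ᵐ[P] fun ω => ∇ (FedPBC.localObjective (ℓ i) (D i))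
          (FedPBC.clientModel ℓ ξ A η s x₀ t i ω))
    (h_variance : ∀ t < T, ∀ i x,
      Integrable (fun ω => ‖FedPBC.stochGrad (ℓ i) (ξ i t ω) x
        - ∇ (FedPBC.localObjective (ℓ i) (D i)) x‖ ^ 2) P ∧
      P[fun ω => ‖FedPBC.stochGrad (ℓ i) (ξ i t ω) x
          - ∇ (FedPBC.localObjective (ℓ i) (D i)) x‖ ^ 2 | FedPBC.history ξ A t]
        ≤ᵐ[P] fun _ => σ ^ 2)
    -- the global objective is bounded below
    (Fstar : ℝ) (hFstar : ∀ x, Fstar ≤ FedPBC.globalObjective ℓ D x)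
    -- bounded gradient dissimilarity
    (β ζ : ℝ)
    (h_dissim : ∀ x, (1 / (m : ℝ)) * ∑ i, ‖∇ (FedPBC.localObjective (ℓ i) (D i)) x
        - ∇ (FedPBC.globalObjective ℓ D) x‖ ^ 2
      ≤ β ^ 2 * ‖∇ (FedPBC.globalObjective ℓ D) x‖ ^ 2 + ζ ^ 2)
    -- condition on the learning rate
    (hη_le : η ≤ (1 - √(FedPBC.rho hm P A T)) /
      (108 * FedPBC.maxLip L ^ 2 * (s : ℝ) ^ 3 * (β ^ 2 + 1) *
        (1 + FedPBC.kappa L η s ^ 2 * FedPBC.maxLip L ^ 2))) :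
    (∀ t < T, Integrable (fun ω =>
      ‖∇ (FedPBC.globalObjective ℓ D) (FedPBC.avgModel ℓ ξ A η s x₀ t ω)‖ ^ 2) P) ∧
    (1 / (T : ℝ)) * ∑ t ∈ Finset.range T,
        ∫ ω, ‖∇ (FedPBC.globalObjective ℓ D) (FedPBC.avgModel ℓ ξ A η s x₀ t ω)‖ ^ 2 ∂P
      ≤ 6 * (FedPBC.globalObjective ℓ D x₀ - Fstar) / (η * s * T)
        + 54 * η * s * FedPBC.maxLip L *
          (FedPBC.kappa L η s ^ 2 * FedPBC.maxLip L ^ 2 + 1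
            + 1 / (1 - √(FedPBC.rho hm P A T))) * (σ ^ 2 + ζ ^ 2) := by
  have : Nonempty (Fin m) := ⟨⟨0, by omega⟩⟩
  let K : ℝ≥0 := ⟨maxLip L, maxLip_nonneg L⟩
  have hℓ i : SmoothLoss (L i) (ℓ i) := ⟨hℓ_meas i, hℓ_diff i, hℓ_lip i⟩
  have hH i : LipschitzWith K (∇ (localObjective (ℓ i) (D i))) :=
    ((hℓ i).lipschitzWith_gradient_localObjective (hℓ_int i)).weaken (le_maxLip L i)
  have hF x := hasGradientAt_globalObjective fun i =>
    ((hℓ i).hasGradientAt_localObjective (hℓ_int i) x).differentiableAt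
  have hdis x : spread (fun i => ∇ (localObjective (ℓ i) (D i)) x)
      ≤ β ^ 2 * ‖mean fun i => ∇ (localObjective (ℓ i) (D i)) x‖ ^ 2 + ζ ^ 2 := by
    simpa only [spread, avgSq, mean, Fintype.card_fin, one_div, (hF x).gradient, smul_eq_mul]
      using h_dissim x
  have hr₁ : √(rho hm P A T) < 1 :=
    sub_pos.1 ((div_pos_iff_of_pos_right (by positivity)).1 (hη.trans_le hη_le))
  simp only [fun x => (hF x).gradient]
  exact ⟨fun t ht => integrable_norm_sq_mean_avgModel hℓ hξ hA hH h_variance hη ht.le,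
    average_integral_norm_sq_mean_avgModel_le hℓ hξ hA hH h_variance hη hm hT hs hL le_rfl
      h_unbiased hA_indep (Real.sqrt_nonneg _) hr₁ (fun _ => lambda2_le_sqrt_rho_sq hm) hF hFstar
      hdis hη_le⟩
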